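/- Let $\Omega=\{0,1,2\}^{\mathbf N}$ be the set of sequences $\omega=(\omega_n)_{n\ge 1}$ with shift $\sigma(\omega)_n=\omega_{n+1}$, and let $\Omega_+\subset\Omega$ be the set of sequences that are not eventually constant. Let $X^*$ be the $2$-regular rooted tree of finite words over $X=\{0,1\}$. Let $a\in\operatorname{Aut}(X^*)$ be the flip, $a(0v)=1v$, $a(1v)=0v$, and for automorphisms $g_0,g_1$ of $X^*$ write $(g_0,g_1)$ for the automorphism $xv\mapsto x\,g_x(v)$ $(x\in X,\ v\in X^*)$. For $\omega\in\Omega$ define automorphisms $b_\omega,c_\omega,d_\omega$ of $X^*$ recursively by $$b_\omega=(a_{\beta(\omega_1)},b_{\sigma(\omega)}),\qquad c_\omega=(a_{\gamma(\omega_1)},c_{\sigma(\omega)}),\qquad d_\omega=(a_{\delta(\omega_1)},d_{\sigma(\omega)}),$$ where $a_{\beta(0)}=a_{\beta(1)}=a$, $a_{\beta(2)}=1$; $a_{\gamma(0)}=a_{\gamma(2)}=a$, $a_{\gamma(1)}=1$; $a_{\delta(1)}=a_{\delta(2)}=a$, $a_{\delta(0)}=1$. Let $G_\omega=\langle a,b_\omega,c_\omega,d_\omega\rangle\le\operatorname{Aut}(X^*)$,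 and let $M_\omega$ be the kernel of the epimorphism $F_4\twoheadrightarrow G_\omega$ from the free group of rank $4$ that sends the four free generators to $a,b_\omega,c_\omega,d_\omega$. For $\Psi\subset\Omega$, the $\Psi$-universal group is $\mathcal U_\Psi=F_4/\bigcap_{\omega\in\Psi}M_\omega$. A finitely generated group is infinitely presented if it is not finitely presented. A cover of a group $G$ is a group $E$ together with an epimorphism $E\twoheadrightarrow G$. A group is large if it has a subgroup of finite index that has a non-abelian free quotient. Then, for every $\Psi\subset\Omega$ with $\Psi\cap\Omega_+\neq\emptyset$, the group $\mathcal U_\Psi$ is infinitely presented, and every finitely presented cover of $\mathcal U_\Psi$ is large. In particular, $\mathcal U_\Omega$ is infinitely presented. -/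

import Mathlib

namespace Grigorchuk

/-- The alphabet `X = {0, 1}`. -/
abbrev X : Type := Fin 2

/-- The space `Ω = {0, 1, 2}^ℕ`. A sequence `(ω_n)_{n ≥ 1}` is indexed
from `0`, so that its first entry `ω_1` is `ω 0`. -/
abbrev Om : Type := ℕ → Fin 3

/-- The shift on `Ω`. -/
def shift (ω : Om) : Om := fun n => ω (n + 1)

/-- `Ω_-`: the eventually constant sequences. -/
def OmMinus : Set Om := {ω | ∃ x : Fin 3, ∃ N : ℕ, ∀ n ≥ N, ω n = x}

/-- `Ω_+`: the complement of `Ω_-`. -/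
def OmPlus : Set Om := OmMinusᶜ

/-- The automorphism group of the `2`-regular rooted tree `X^*`: its vertices are the words over
`X`, its edges join a word `u` to its children `u x`, `x ∈ X`. (The root, being the only vertex
which is not a child, is automatically fixed.) -/
def TreeAut : Subgroup (Equiv.Perm (List X)) where
  carrier := {g | ∀ u v, (∃ x, g v = g u ++ [x]) ↔ ∃ x, v = u ++ [x]}
  one_mem' := fun _ _ => Iff.rfl
  mul_mem' := fun {g h} hg hh u v => (hg (h u) (h v)).trans (hh u v)
  inv_mem' := fun {g} hg u v => by
    have := hg (g⁻¹ u) (g⁻¹ v)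
    have e : ∀ w, g (g⁻¹ w) = w := g.apply_symm_apply
    rw [e, e] at this
    exact this.symm

/-- The underlying map of the flip: `0 v ↦ 1 v`, `1 v ↦ 0 v`. -/
def flipFun : List X → List X
  | [] => []
  | 0 :: v => 1 :: v
  | 1 :: v => 0 :: v

theorem flipFun_flipFun : ∀ v, flipFun (flipFun v) = v
  | [] => rfl
  | 0 :: _ => rfl
  | 1 :: _ => rfl

theorem flipFun_append (u : List X) (x : X) (hu : u ≠ []) :
    flipFun (u ++ [x]) = flipFun u ++ [x] := by
  match u with
  | [] => exact absurd rfl hu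
  | 0 :: _ => rfl
  | 1 :: _ => rfl

theorem exists_flipFun_append (u : List X) (x : X) :
    ∃ y, flipFun (u ++ [x]) = flipFun u ++ [y] := by
  by_cases hu : u = []
  · subst hu
    match x with
    | 0 => exact ⟨1, rfl⟩
    | 1 => exact ⟨0, rfl⟩
  · exact ⟨x, flipFun_append u x hu⟩

/-- A permutation of `X^*` which, together with its inverse, sends children to children is an
automorphism of the tree. -/
theorem mem_treeAut {g : Equiv.Perm (List X)} (h : ∀ u x, ∃ y, g (u ++ [x]) = g u ++ [y])
    (h' : ∀ u x, ∃ y, g.symm (u ++ [x]) = g.symm u ++ [y]) : g ∈ TreeAut := by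
  intro u v
  constructor
  · rintro ⟨x, hx⟩
    obtain ⟨y, hy⟩ := h' (g u) x
    rw [← hx] at hy
    exact ⟨y, by simpa using hy⟩
  · rintro ⟨x, rfl⟩
    exact h u x

theorem exists_append_of_mem {g : Equiv.Perm (List X)} (h : g ∈ TreeAut) (u : List X) (x : X) :
    ∃ y, g (u ++ [x]) = g u ++ [y] :=
  (h u (u ++ [x])).2 ⟨x, rfl⟩

theorem apply_nil_of_mem {g : Equiv.Perm (List X)} (h : g ∈ TreeAut) : g [] = [] := by
  rcases List.eq_nil_or_concat (g []) with h0 | ⟨w, x, hw⟩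
  · exact h0
  · obtain ⟨y, hy⟩ := (h (g⁻¹ w) []).1 ⟨x, by simpa using hw⟩
    simp at hy

/-- The flip `a ∈ Aut(X^*)`. -/
def a : TreeAut :=
  ⟨⟨flipFun, flipFun, flipFun_flipFun, flipFun_flipFun⟩,
    mem_treeAut exists_flipFun_append exists_flipFun_append⟩

/-- The underlying map of the automorphism `g_ω` given by the recursion
`g_ω = (s (ω_1), g_{σ(ω)})`, that is `g_ω (0 v) = 0 (s (ω_1) v)`,
`g_ω (1 v) = 1 (g_{σ(ω)} v)`. -/
def spineFun (s : Fin 3 → TreeAut) : Om → List X → List X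
  | _, [] => []
  | ω, 0 :: v => 0 :: (s (ω 0)).1 v
  | ω, 1 :: v => 1 :: spineFun s (shift ω) v

theorem spineFun_inv (s : Fin 3 → TreeAut) :
    ∀ (ω : Om) (v : List X), spineFun s⁻¹ ω (spineFun s ω v) = v
  | _, [] => rfl
  | ω, 0 :: v => by simp [spineFun]
  | ω, 1 :: v => by simp [spineFun, spineFun_inv s (shift ω) v]

theorem exists_spineFun_append (s : Fin 3 → TreeAut) :
    ∀ (ω : Om) (u : List X) (x : X), ∃ y, spineFun s ω (u ++ [x]) = spineFun s ω u ++ [y]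
  | ω, [], 0 => ⟨0, by simp [spineFun, apply_nil_of_mem (s (ω 0)).2]⟩
  | ω, [], 1 => ⟨1, by simp [spineFun]⟩
  | ω, 0 :: v, x => by
      obtain ⟨y, hy⟩ := exists_append_of_mem (s (ω 0)).2 v x
      exact ⟨y, by simp [spineFun, hy]⟩
  | ω, 1 :: v, x => by
      obtain ⟨y, hy⟩ := exists_spineFun_append s (shift ω) v x
      exact ⟨y, by simp [spineFun, hy]⟩

/-- The automorphisms `g_ω = (s (ω_1), g_{σ(ω)})` of `X^*`. -/
def spine (s : Fin 3 → TreeAut) (ω : Om) : TreeAut :=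
  ⟨⟨spineFun s ω, spineFun s⁻¹ ω, spineFun_inv s ω,
      fun v => by simpa using spineFun_inv s⁻¹ ω v⟩,
    mem_treeAut (exists_spineFun_append s ω) (exists_spineFun_append s⁻¹ ω)⟩

/-- `b_ω = (a_{β(ω_1)}, b_{σ(ω)})`. -/
def b (ω : Om) : TreeAut := spine ![a, a, 1] ω

/-- `c_ω = (a_{γ(ω_1)}, c_{σ(ω)})`. -/
def c (ω : Om) : TreeAut := spine ![a, 1, a] ω

/-- `d_ω = (a_{δ(ω_1)}, d_{σ(ω)})`. -/
def d (ω : Om) : TreeAut := spine ![1, a, a] ω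

/-- The marking `S_ω = (a, b_ω, c_ω, d_ω)`. -/
def S (ω : Om) : Fin 4 → TreeAut := ![a, b ω, c ω, d ω]

/-- The group `G_ω`, generated by `S_ω`. -/
def G (ω : Om) : Subgroup TreeAut := Subgroup.closure (Set.range (S ω))

/-- The defining cover `F_4 ↠ G_ω`, sending the free generators to `a, b_ω, c_ω, d_ω`. -/
def cover (ω : Om) : FreeGroup (Fin 4) →* G ω :=
  FreeGroup.lift fun i => ⟨S ω i, Subgroup.subset_closure ⟨i, rfl⟩⟩

/-- The kernel `M_ω` of the defining cover. -/
def M (ω : Om) : Subgroup (FreeGroup (Fin 4)) := (cover ω).ker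

/-- The intersection of the `M_ω`, `ω ∈ Ψ` (all of `F_4` if `Ψ` is empty). -/
def MInter (Ψ : Set Om) : Subgroup (FreeGroup (Fin 4)) := ⨅ ω ∈ Ψ, M ω

instance (Ψ : Set Om) : (MInter Ψ).Normal :=
  Subgroup.normal_iInf_normal fun ω => Subgroup.normal_iInf_normal fun _ =>
    MonoidHom.normal_ker (cover ω)

/-- The `Ψ`-universal group `U_Ψ = F_4 / ⋂_{ω ∈ Ψ} M_ω`. -/
abbrev U (Ψ : Set Om) : Type := FreeGroup (Fin 4) ⧸ MInter Ψ

/-- A group is infinitely presented if it is finitely generated and not finitely presented. -/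
def InfinitelyPresented (Γ : Type*) [Group Γ] : Prop :=
  Group.FG Γ ∧ ¬ Group.IsFinitelyPresented Γ

/-- A group is large if it has a subgroup of finite index that has a non-abelian free quotient,
that is, a surjective homomorphism onto a free group of rank at least `2`. (Such a free group maps
onto the free group of rank `2`, so it does no harm that `α` lives in the lowest universe.) -/
def Large (Γ : Type*) [Group Γ] : Prop :=
  ∃ H : Subgroup Γ, H.FiniteIndex ∧
    ∃ α : Type, Nontrivial α ∧ ∃ f : H →* FreeGroup α, Function.Surjective f

end Grigorchuk

/-!
All the groups `G_ω` are quotients of the free product `KV = ⟨a, b, c, d ∣ a², b², c², d², bcd⟩` of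
`C₂` and the Klein four-group, and the recursion for the generators makes sense in `KV`: an element
has sections in `KV` at the vertices of the tree (`sec`), and `tree_append` expresses the action
through `G_ω` by these sections. Passing to the next level roughly halves the number of letters `a`
(`KV.AltLen.sec1`), so sections on deep levels lie in `{1, a, b, c, d}`
(`exists_sec_mem_nucleus`).

*Finitely presented covers are large* (`large_of_range_eq`). Let `ω` be not eventually constant.
Then `a, b_ω, c_ω, d_ω` are nontrivial, and the same holds for all shifts of `ω`. Hence an element
of `KV` that acts trivially through `G_ω` has trivial sections in `KV` on every deep level: the
kernel of `KV → G_ω` is contained in the union of the normal subgroups `deepKer ω n` of elements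
that fix level `n` and have trivial sections there. Given a cover of `G_ω` with finitely many
relators, lift its generators to `KV`; the relators land in `deepKer ω n` for some `n`, and the
cover maps onto `KV / deepKer ω n`. The stabilizer of the vertex `1ⁿ` has finite index and maps onto
`KV` by taking sections, and `KV` is large (`large_KV`), being virtually free.

*The universal groups are not large* (`not_large_U`). A homomorphism `φ` from a finite index subgroup
of `KV` to a free group, with nonabelian image, which kills the intersection of finitely many normal
subgroups kills one of them, since elementwise commuting nontrivial normal subgroups do not exist in
a nonabelian free group. If `φ` factors through the universal group, this applies to the subgroups
of elements acting trivially on the subtree at `v` for all `ω ∈ Ψ` with prefix `u`, where `u` and `v`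
run through the words of length `n`. As free groups are torsion-free, `φ` therefore kills every
element that fixes a certain `v` and has trivial section there (`exists_kills_vertex`). So the value
of `φ` depends only on the image of `v` and on the section at `v`; by contraction these
take only linearly many values on a ball of radius about `2 ^ n`, whereas the values of `φ` on that
ball grow exponentially (`false_of_kills`).

Thus a finitely presented universal group would be a finitely presented cover of itself, hence
large, which it is not.
-/

open Function
open scoped commutatorElement

/-! ### Commuting elements in free groups -/

theorem FreeGroup.commute_of_subsingleton {α : Type*} [Subsingleton α] (x y : FreeGroup α) :
    Commute x y := by
  rcases isEmpty_or_nonempty α with h | ⟨⟨i⟩⟩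
  · exact Subsingleton.elim _ _
  · have key : ∀ z : FreeGroup α, z ∈ Subgroup.zpowers (FreeGroup.of i) := by
      intro z
      induction z using FreeGroup.induction_on with
      | C1 => exact one_mem _
      | of j => rw [Subsingleton.elim j i]; exact Subgroup.mem_zpowers _
      | inv_of j h => exact inv_mem h
      | mul a b ha hb => exact mul_mem ha hb
    obtain ⟨m, rfl⟩ := key x
    obtain ⟨n, rfl⟩ := key y
    exact Commute.zpow_zpow_self _ _ _

instance IsFreeGroup.instIsMulTorsionFree {K : Type*} [Group K] [IsFreeGroup K] :
    IsMulTorsionFree K :=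
  Function.Injective.isMulTorsionFree (IsFreeGroup.toFreeGroup K).toMonoidHom
    (IsFreeGroup.toFreeGroup K).injective

/-- A commutative free group is cyclic. -/
theorem IsFreeGroup.exists_generator_of_commute {C : Type*} [Group C] [IsFreeGroup C]
    (hC : ∀ u v : C, Commute u v) : ∃ z : C, ∀ w : C, w ∈ Subgroup.zpowers z := by
  let e := IsFreeGroup.toFreeGroup C
  have hsub : Subsingleton (IsFreeGroup.Generators C) := by
    refine ⟨fun i j => FreeGroup.of_injective ?_⟩
    by_contra hij
    have hij' : i ≠ j := fun h => hij (by rw [h])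
    have h1 : FreeGroup.of i * FreeGroup.of j = FreeGroup.of j * FreeGroup.of i := by
      have := hC (e.symm (FreeGroup.of i)) (e.symm (FreeGroup.of j))
      simpa using congrArg e this.eq
    classical
    have h2 := congrArg FreeGroup.toWord h1
    simp [FreeGroup.of, FreeGroup.mul_mk, FreeGroup.toWord_mk, FreeGroup.reduce.cons, hij'] at h2
  rcases isEmpty_or_nonempty (IsFreeGroup.Generators C) with h0 | ⟨⟨i⟩⟩
  · refine ⟨1, fun w => ?_⟩
    rw [show w = 1 from e.injective (Subsingleton.elim _ _)]
    exact one_mem _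
  · refine ⟨e.symm (FreeGroup.of i), fun w => ?_⟩
    obtain ⟨w, rfl⟩ := e.symm.surjective w
    induction w using FreeGroup.induction_on with
    | C1 => rw [map_one]; exact one_mem _
    | of j => rw [Subsingleton.elim j i]; exact Subgroup.mem_zpowers _
    | inv_of j h => rw [map_inv]; exact inv_mem h
    | mul a b ha hb => rw [map_mul]; exact mul_mem ha hb

/-- Commuting elements of a free group are powers of a common element: by the Nielsen–Schreier
theorem they generate a free group, which is cyclic since it is commutative. -/
theorem IsFreeGroup.exists_zpow_of_commute {K : Type*} [Group K] [IsFreeGroup K] {x y : K}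
    (h : Commute x y) : ∃ (z : K) (m n : ℤ), x = z ^ m ∧ y = z ^ n := by
  let C : Subgroup K := Subgroup.closure {x, y}
  have hx : x ∈ C := Subgroup.subset_closure (by simp)
  have hy : y ∈ C := Subgroup.subset_closure (by simp)
  have hC : ∀ u v : C, Commute u v := by
    have hcomm : ∀ u ∈ ({x, y} : Set K), ∀ v ∈ ({x, y} : Set K), u * v = v * u := by
      rintro u (rfl | rfl) v (rfl | rfl) <;> first | rfl | exact h | exact h.symm
    have := Subgroup.isMulCommutative_closure hcomm
    exact fun u v => this.is_comm.comm u v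
  obtain ⟨z, hz⟩ := IsFreeGroup.exists_generator_of_commute hC
  obtain ⟨m, hm⟩ := hz ⟨x, hx⟩
  obtain ⟨n, hn⟩ := hz ⟨y, hy⟩
  exact ⟨z, m, n, by simpa using (congrArg Subtype.val hm).symm,
    by simpa using (congrArg Subtype.val hn).symm⟩

/-- An element of a free group commuting with a free generator is a power of it. -/
theorem FreeGroup.exists_zpow_of_commute_of {α : Type*} {i : α} {x : FreeGroup α}
    (h : Commute x (FreeGroup.of i)) : ∃ m : ℤ, x = FreeGroup.of i ^ m := by
  obtain ⟨z, m, n, rfl, hn⟩ := IsFreeGroup.exists_zpow_of_commute h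
  -- The exponent sum shows that the generator is not a proper power.
  have h1 := congrArg (FreeGroup.lift fun _ => Multiplicative.ofAdd (1 : ℤ)) hn
  rw [map_zpow, FreeGroup.lift_apply_of] at h1
  have h2 : (1 : ℤ) = n * Multiplicative.toAdd
      (FreeGroup.lift (fun _ => Multiplicative.ofAdd (1 : ℤ)) z) := by
    simpa using congrArg Multiplicative.toAdd h1
  rcases Int.isUnit_iff.1 (IsUnit.of_mul_eq_one _ h2.symm) with rfl | rfl
  · exact ⟨m, by rw [hn, zpow_one]⟩
  · exact ⟨-m, by rw [hn]; simp⟩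

/-- A free group with a nontrivial central element is commutative. -/
theorem IsFreeGroup.commute_of_central {K : Type*} [Group K] [IsFreeGroup K] {x : K}
    (hx : x ≠ 1) (h : ∀ y, Commute x y) (u v : K) : Commute u v := by
  let e := IsFreeGroup.toFreeGroup K
  suffices hsub : Subsingleton (IsFreeGroup.Generators K) by
    have := FreeGroup.commute_of_subsingleton (e u) (e v)
    exact e.injective (by simpa using this.eq)
  refine ⟨fun i j => by_contra fun hij => hx (e.injective ?_)⟩
  have hc : ∀ k, Commute (e x) (FreeGroup.of k) := fun k => by
    have := congrArg e (h (e.symm (FreeGroup.of k))).eq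
    rwa [map_mul, map_mul, e.apply_symm_apply] at this
  obtain ⟨m, hm⟩ := FreeGroup.exists_zpow_of_commute_of (hc i)
  obtain ⟨n, hn⟩ := FreeGroup.exists_zpow_of_commute_of (hc j)
  classical
  have h1 := congrArg (FreeGroup.lift fun k =>
    if k = i then Multiplicative.ofAdd (1 : ℤ) else 1) (hm.symm.trans hn)
  rw [map_zpow, map_zpow, FreeGroup.lift_apply_of, FreeGroup.lift_apply_of, if_pos rfl,
    if_neg (Ne.symm hij), one_zpow] at h1
  have h2 : m = 0 := by simpa using congrArg Multiplicative.toAdd h1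
  rw [hm, h2, zpow_zero, map_one]

/-- Commutation is transitive on the nontrivial elements of a free group. -/
theorem IsFreeGroup.commute_trans {K : Type*} [Group K] [IsFreeGroup K] {x u v : K}
    (hx : x ≠ 1) (hu : Commute x u) (hv : Commute x v) : Commute u v := by
  let C := Subgroup.centralizer {x}
  have mem : ∀ {w}, Commute x w → w ∈ C := fun hw =>
    Subgroup.mem_centralizer_singleton_iff.2 hw.eq.symm
  have key := IsFreeGroup.commute_of_central (K := C) (x := ⟨x, mem (Commute.refl x)⟩)
    (fun h0 => hx (congrArg Subtype.val h0))
    (fun y => Subtype.ext (Subgroup.mem_centralizer_singleton_iff.1 y.2).symm)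
    ⟨u, mem hu⟩ ⟨v, mem hv⟩
  exact congrArg Subtype.val key.eq

/-- Two nontrivial normal subgroups of a free group that commute elementwise force the whole
group to be commutative. -/
theorem IsFreeGroup.commute_of_normal_commute {K : Type*} [Group K] [IsFreeGroup K]
    {A B : Subgroup K} [A.Normal] (hAB : ∀ a ∈ A, ∀ b ∈ B, Commute a b)
    {a b : K} (ha : a ∈ A) (hb : b ∈ B) (ha1 : a ≠ 1) (hb1 : b ≠ 1) (u v : K) :
    Commute u v := by
  refine IsFreeGroup.commute_of_central ha1 (fun p => ?_) u v
  -- The centralizer `Z` of `a` is infinite cyclic, and it is normal because all conjugates of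
  -- `a` commute with `b`, hence with `a`.
  let Z := Subgroup.centralizer {a}
  have mem : ∀ {w}, w ∈ Z ↔ Commute a w := Subgroup.mem_centralizer_singleton_iff.trans eq_comm
  have hconj : ∀ q, Commute a (q * a * q⁻¹) := fun q =>
    IsFreeGroup.commute_trans hb1 (hAB _ ha _ hb).symm
      (hAB _ (Subgroup.Normal.conj_mem ‹_› a ha q) _ hb).symm
  have hZ : ∀ q, ∀ y ∈ Z, q * y * q⁻¹ ∈ Z := fun q y hy => mem.2 <|
    IsFreeGroup.commute_trans (x := q * a * q⁻¹) (by simpa using ha1) (hconj q).symm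
      (((mem.1 hy).map (MulAut.conj q).toMonoidHom) :)
  obtain ⟨⟨z, hzZ⟩, hz⟩ := IsFreeGroup.exists_generator_of_commute (C := Z)
    fun s t => Subtype.ext (IsFreeGroup.commute_trans ha1 (mem.1 s.2) (mem.1 t.2)).eq
  have hz' : ∀ w ∈ Z, ∃ k : ℤ, w = z ^ k := fun w hw => by
    obtain ⟨k, hk⟩ := hz ⟨w, hw⟩
    exact ⟨k, by simpa using (congrArg Subtype.val hk).symm⟩
  have hz1 : z ≠ 1 := by
    rintro rfl
    obtain ⟨k, hk⟩ := hz' a (mem.2 (Commute.refl a))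
    exact ha1 (by simpa using hk)
  -- An automorphism of an infinite cyclic group has trivial square, so `p ^ 2` commutes with `z`.
  obtain ⟨k, hk⟩ := hz' _ (hZ p z hzZ)
  obtain ⟨l, hl⟩ := hz' _ (hZ p⁻¹ z hzZ)
  have hkl : z ^ (k * l) = z ^ (1 : ℤ) := by
    rw [zpow_mul, ← hk, conj_zpow, ← hl]; group
  have hkl' : k * l = 1 := by
    rw [← sub_eq_zero, ← IsMulTorsionFree.zpow_eq_one_iff_right hz1, zpow_sub, hkl, mul_inv_cancel]
  have hkk : k * k = 1 := by
    rcases Int.isUnit_iff.1 (IsUnit.of_mul_eq_one _ hkl') with rfl | rfl <;> norm_num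
  have hp2 : Commute (p ^ 2) z := by
    have : p * (p * z * p⁻¹) * p⁻¹ = z := by
      rw [hk, ← conj_zpow, hk, ← zpow_mul, hkk, zpow_one]
    calc p ^ 2 * z = p * (p * z * p⁻¹) * p⁻¹ * p ^ 2 := by simp only [pow_two]; group
      _ = z * p ^ 2 := by rw [this]
  have hpz : Commute z p := by
    by_cases hp : p ^ 2 = 1
    · rw [pow_eq_one_iff_left two_ne_zero] at hp
      rw [hp]; exact Commute.one_right z
    · exact IsFreeGroup.commute_trans hp hp2 ((Commute.refl p).pow_left 2)
  obtain ⟨m, hm⟩ := hz' a (mem.2 (Commute.refl a))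
  rw [hm]
  exact hpz.zpow_left m

/-- A homomorphism to a free group with nonabelian image which kills the intersection of two normal
subgroups kills one of them: it kills `⁅N₁, N₂⁆`, so the images of `N₁` and `N₂` commute. -/
theorem IsFreeGroup.le_ker_or_le_ker {H K : Type*} [Group H] [Group K] [IsFreeGroup K]
    {φ : H →* K} {x y : H} (hφ : ¬ Commute (φ x) (φ y)) {N₁ N₂ : Subgroup H} [N₁.Normal]
    [N₂.Normal] (h : N₁ ⊓ N₂ ≤ φ.ker) : N₁ ≤ φ.ker ∨ N₂ ≤ φ.ker := by
  by_contra! hcon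
  obtain ⟨h1, h2⟩ := hcon
  obtain ⟨a, ha, ha1⟩ := SetLike.not_le_iff_exists.1 h1
  obtain ⟨b, hb, hb1⟩ := SetLike.not_le_iff_exists.1 h2
  have : (N₁.map φ.rangeRestrict).Normal :=
    Subgroup.Normal.map inferInstance _ φ.rangeRestrict_surjective
  have key := IsFreeGroup.commute_of_normal_commute (K := φ.range)
    (A := N₁.map φ.rangeRestrict) (B := N₂.map φ.rangeRestrict) ?_
    (Subgroup.mem_map_of_mem _ ha) (Subgroup.mem_map_of_mem _ hb)
    (fun h => ha1 (congrArg Subtype.val h)) (fun h => hb1 (congrArg Subtype.val h))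
    (φ.rangeRestrict x) (φ.rangeRestrict y)
  · exact hφ (congrArg Subtype.val key.eq)
  · rintro _ ⟨u, hu, rfl⟩ _ ⟨v, hv, rfl⟩
    have huv : φ ⁅u, v⁆ = 1 :=
      h (Subgroup.commutator_le_inf N₁ N₂ (Subgroup.commutator_mem_commutator hu hv))
    refine Subtype.ext ?_
    rw [map_commutatorElement, commutatorElement_eq_one_iff_mul_comm] at huv
    exact huv

theorem IsFreeGroup.exists_le_ker_of_iInf_le_ker {H K ι : Type*} [Group H] [Group K]
    [IsFreeGroup K] [Finite ι] {φ : H →* K} {x y : H} (hφ : ¬ Commute (φ x) (φ y))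
    (N : ι → Subgroup H) (hN : ∀ i, (N i).Normal) (h : ⨅ i, N i ≤ φ.ker) :
    ∃ i, N i ≤ φ.ker := by
  cases nonempty_fintype ι
  classical
  have key : ∀ s : Finset ι, ⨅ i ∈ s, N i ≤ φ.ker → ∃ i, N i ≤ φ.ker := by
    intro s
    induction s using Finset.induction_on with
    | empty =>
      intro h
      have hx : φ x = 1 := h (by simp)
      exact absurd (hx ▸ Commute.one_left (φ y)) hφ
    | insert i s _ ih =>
      intro h
      rw [Finset.iInf_insert] at h
      have : (⨅ j ∈ s, N j).Normal :=
        Subgroup.normal_iInf_normal fun j => Subgroup.normal_iInf_normal fun _ => hN j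
      have := hN i
      exact (IsFreeGroup.le_ker_or_le_ker hφ h).elim (fun h => ⟨i, h⟩) ih
  exact key Finset.univ (by simpa using h)

/-- Distinct positive words represent distinct elements of a free group. -/
theorem FreeGroup.prod_map_of_injective {α : Type*} :
    Injective fun l : List α => (l.map FreeGroup.of).prod := by
  classical
  have key : ∀ l : List α, ((l.map FreeGroup.of).prod).toWord = l.map fun i => (i, true) := by
    intro l
    have hmk : (l.map FreeGroup.of).prod = FreeGroup.mk (l.map fun i => (i, true)) := by
      induction l with
      | nil => rfl
      | cons i l ih => rw [List.map_cons, List.prod_cons, ih]; rfl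
    rw [hmk, FreeGroup.toWord_mk, ← FreeGroup.isReduced_iff_reduce_eq]
    refine (List.isChain_map _).2 ?_
    clear hmk
    induction l with
    | nil => exact List.IsChain.nil
    | cons i l ih => exact List.isChain_cons.2 ⟨fun _ _ _ => rfl, ih⟩
  intro l l' h
  have := congrArg FreeGroup.toWord h
  simp only [key] at this
  exact List.map_injective_iff.2 (fun i j h => congrArg Prod.fst h) this

namespace Grigorchuk

/-! ### Large groups -/

theorem Large.exists_map_eq_of {Γ : Type*} [Group Γ] (h : Large Γ) :
    ∃ H : Subgroup Γ, H.FiniteIndex ∧ ∃ (α : Type) (f : H →* FreeGroup α) (x y : H) (i j : α),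
      i ≠ j ∧ f x = FreeGroup.of i ∧ f y = FreeGroup.of j := by
  obtain ⟨H, hH, α, ⟨i, j, hij⟩, f, hf⟩ := h
  obtain ⟨x, hx⟩ := hf (FreeGroup.of i)
  obtain ⟨y, hy⟩ := hf (FreeGroup.of j)
  exact ⟨H, hH, α, f, x, y, i, j, hij, hx, hy⟩

/-- By the Nielsen–Schreier theorem it suffices for largeness that some finite index subgroup
has a nonabelian image in a free group. -/
theorem large_of_not_commute {Γ : Type*} [Group Γ] (H : Subgroup Γ) [H.FiniteIndex] {β : Type}
    (g : H →* FreeGroup β) {x y : H} (h : ¬ Commute (g x) (g y)) : Large Γ := by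
  let e := IsFreeGroup.toFreeGroup g.range
  refine ⟨H, inferInstance, IsFreeGroup.Generators g.range, ?_,
    e.toMonoidHom.comp g.rangeRestrict, e.surjective.comp g.rangeRestrict_surjective⟩
  by_contra hsub
  rw [not_nontrivial_iff_subsingleton] at hsub
  have := FreeGroup.commute_of_subsingleton (e (g.rangeRestrict x)) (e (g.rangeRestrict y))
  have hxy : g.rangeRestrict x * g.rangeRestrict y = g.rangeRestrict y * g.rangeRestrict x :=
    e.injective (by rw [map_mul, map_mul, this.eq])
  exact h (congrArg Subtype.val hxy)

theorem Large.of_finiteIndex {Γ T : Type*} [Group Γ] [Group T] (hT : Large T) (H : Subgroup Γ)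
    [H.FiniteIndex] {t : H →* T} (ht : Surjective t) : Large Γ := by
  obtain ⟨L, hL, α, hα, f, hf⟩ := hT
  let e := (L.comap t).equivMapOfInjective H.subtype H.subtype_injective
  have : ((L.comap t).map H.subtype).FiniteIndex :=
    ⟨by
      rw [Subgroup.index_map_subtype, L.index_comap_of_surjective ht]
      exact mul_ne_zero Subgroup.FiniteIndex.index_ne_zero Subgroup.FiniteIndex.index_ne_zero⟩
  refine ⟨(L.comap t).map H.subtype, this, α, hα,
    (f.comp (t.subgroupComap L)).comp e.symm.toMonoidHom, ?_⟩
  exact (hf.comp (t.subgroupComap_surjective_of_surjective L ht)).comp e.symm.surjective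

/-- If a finite index subgroup `H` of `Γ` has a large quotient, through a homomorphism that kills
the part in `H` of the kernel of `π : Γ → Q`, then `Q` is large. -/
theorem Large.of_surjective {Γ Q T : Type*} [Group Γ] [Group Q] [Group T] (hT : Large T)
    {π : Γ →* Q} (hπ : Surjective π) (H : Subgroup Γ) [H.FiniteIndex] {s : H →* T}
    (hs : Surjective s) (hker : ∀ h : H, π h = 1 → s h = 1) : Large Q := by
  have hsurj := π.subgroupMap_surjective H
  have : (H.map π).FiniteIndex :=
    ⟨fun h => Subgroup.FiniteIndex.index_ne_zero (H := H)
      (Nat.eq_zero_of_zero_dvd (h ▸ H.index_map_dvd hπ) : _)⟩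
  let t : H.map π →* T := (π.subgroupMap H).liftOfSurjective hsurj
    ⟨s, fun h hh => hker h (congrArg Subtype.val hh)⟩
  refine hT.of_finiteIndex (H.map π) (t := t) fun y => ?_
  obtain ⟨h, rfl⟩ := hs y
  exact ⟨π.subgroupMap H h, MonoidHom.liftOfRightInverse_comp_apply _ _ _ _ h⟩

/-! ### The free product of a group of order two and a Klein four-group -/

/-- The relators `a², b², c², d², bcd`, satisfied by the generators of all the groups `G_ω`. -/
def kleinRels : Set (FreeGroup (Fin 4)) :=
  {r | (∃ i, r = FreeGroup.of i * FreeGroup.of i) ∨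
    r = FreeGroup.of 1 * FreeGroup.of 2 * FreeGroup.of 3}

/-- The group `⟨a, b, c, d ∣ a², b², c², d², bcd⟩`, the free product of a group of order two and a
Klein four-group. It maps onto every `G_ω`. -/
abbrev KV : Type := PresentedGroup kleinRels

namespace KV

/-- The generators `a, b, c, d`, numbered from `0` to `3`. -/
def gen (i : Fin 4) : KV := PresentedGroup.of i

theorem gen_mul_self (i : Fin 4) : gen i * gen i = 1 :=
  PresentedGroup.one_of_mem (rels := kleinRels) (Or.inl ⟨i, rfl⟩)

theorem gen_inv (i : Fin 4) : (gen i)⁻¹ = gen i := inv_eq_of_mul_eq_one_left (gen_mul_self i)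

theorem gen_one_mul_gen_two_mul_gen_three : gen 1 * gen 2 * gen 3 = 1 :=
  PresentedGroup.one_of_mem (rels := kleinRels) (Or.inr rfl)

section Lift

variable {T : Type*} [Group T]

/-- The homomorphism from `⟨a, b, c, d ∣ a², b², c², d², bcd⟩` given by images of the generators
that satisfy the relations. -/
def lift (f : Fin 4 → T) (h : ∀ i, f i * f i = 1) (h' : f 1 * f 2 * f 3 = 1) : KV →* T :=
  PresentedGroup.toGroup (f := f) (by
    rintro r (⟨i, rfl⟩ | rfl)
    · simpa using h i
    · simpa using h')

@[simp] theorem lift_gen (f : Fin 4 → T) (h : ∀ i, f i * f i = 1) (h' : f 1 * f 2 * f 3 = 1)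
    (i : Fin 4) : lift f h h' (gen i) = f i := PresentedGroup.toGroup.of _

end Lift

theorem induction {P : KV → Prop} (one : P 1) (gen_mul : ∀ i g, P g → P (gen i * g)) (g : KV) :
    P g := by
  have key : ∀ w : FreeGroup (Fin 4), ∀ h, P h → P (PresentedGroup.mk kleinRels w * h) := by
    intro w
    induction w using FreeGroup.induction_on with
    | C1 => intro h hh; rwa [map_one, one_mul]
    | of i => exact gen_mul i
    | inv_of i _ =>
      intro h hh
      rw [map_inv]
      change P ((gen i)⁻¹ * h)
      rw [gen_inv]
      exact gen_mul i h hh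
    | mul u v hu hv =>
      intro h hh
      rw [map_mul, mul_assoc]
      exact hu _ (hv _ hh)
  obtain ⟨w, rfl⟩ := PresentedGroup.mk_surjective kleinRels g
  simpa using key w 1 one

theorem hom_ext {T : Type*} [Group T] {f g : KV →* T} (h : ∀ i, f (gen i) = g (gen i)) : f = g :=
  PresentedGroup.ext h

/-- The four elements `1, b, c, d`. -/
def klein : Set KV := {1, gen 1, gen 2, gen 3}

theorem gen_one_mul_gen_two : gen 1 * gen 2 = gen 3 := by
  rw [← gen_inv 3, eq_inv_iff_mul_eq_one]; exact gen_one_mul_gen_two_mul_gen_three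

theorem gen_two_mul_gen_one : gen 2 * gen 1 = gen 3 := by
  rw [← gen_inv 3, ← gen_one_mul_gen_two, mul_inv_rev, gen_inv, gen_inv]

theorem gen_two_mul_gen_three : gen 2 * gen 3 = gen 1 := by
  rw [← gen_two_mul_gen_one, ← mul_assoc, gen_mul_self, one_mul]

theorem gen_three_mul_gen_two : gen 3 * gen 2 = gen 1 := by
  rw [← gen_one_mul_gen_two, mul_assoc, gen_mul_self, mul_one]

theorem gen_one_mul_gen_three : gen 1 * gen 3 = gen 2 := by
  rw [← gen_one_mul_gen_two, ← mul_assoc, gen_mul_self, one_mul]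

theorem gen_three_mul_gen_one : gen 3 * gen 1 = gen 2 := by
  rw [← gen_two_mul_gen_one, mul_assoc, gen_mul_self, mul_one]

theorem one_mem_klein : (1 : KV) ∈ klein := Or.inl rfl

theorem mul_mem_klein {u v : KV} (hu : u ∈ klein) (hv : v ∈ klein) : u * v ∈ klein := by
  rcases hu with rfl | rfl | rfl | rfl <;> rcases hv with rfl | rfl | rfl | rfl <;>
    simp [klein, gen_mul_self, gen_one_mul_gen_two, gen_two_mul_gen_one, gen_two_mul_gen_three,
      gen_three_mul_gen_two, gen_one_mul_gen_three, gen_three_mul_gen_one]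

/-- `AltLen k g` says that `g` can be written with at most `k` letters `a`, as
`v₀ a v₁ a ⋯ a vⱼ` with `j ≤ k` and all `vᵢ ∈ {1, b, c, d}`. -/
inductive AltLen : ℕ → KV → Prop
  | base {k : ℕ} {v : KV} (hv : v ∈ klein) : AltLen k v
  | step {k : ℕ} {v h : KV} (hv : v ∈ klein) (hh : AltLen k h) : AltLen (k + 1) (v * gen 0 * h)

namespace AltLen

theorem mono {k l : ℕ} {g : KV} (h : AltLen k g) (hkl : k ≤ l) : AltLen l g := by
  induction h generalizing l with
  | base hv => exact base hv
  | step hv _ ih =>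
    obtain ⟨l, rfl⟩ := Nat.exists_eq_add_of_le' (Nat.one_le_of_lt hkl)
    exact step hv (ih (Nat.le_of_succ_le_succ hkl))

theorem klein_mul {k : ℕ} {v g : KV} (hv : v ∈ klein) (h : AltLen k g) : AltLen k (v * g) := by
  cases h with
  | base hw => exact base (mul_mem_klein hv hw)
  | step hw hh =>
    rw [← mul_assoc, ← mul_assoc]
    exact step (mul_mem_klein hv hw) hh

theorem mul {k l : ℕ} {g h : KV} (hg : AltLen k g) (hh : AltLen l h) : AltLen (k + l) (g * h) := by
  induction hg with
  | base hv => exact (klein_mul hv hh).mono (Nat.le_add_left _ _)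
  | @step k v _ hv _ ih =>
    rw [mul_assoc, Nat.succ_add]
    exact step hv ih

theorem gen_zero : AltLen 1 (gen 0) := by
  simpa using step (k := 0) one_mem_klein (base one_mem_klein)

theorem gen (i : Fin 4) : AltLen 1 (gen i) := by
  fin_cases i
  · exact gen_zero
  all_goals exact base (by simp [klein])

theorem exists_altLen (g : KV) : ∃ k, AltLen k g := by
  induction g using KV.induction with
  | one => exact ⟨0, base one_mem_klein⟩
  | gen_mul i g ih =>
    obtain ⟨k, hk⟩ := ih
    exact ⟨1 + k, (gen i).mul hk⟩

theorem list_prod {k : ℕ} {l : List KV} (h : ∀ g ∈ l, AltLen k g) :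
    AltLen (k * l.length) l.prod := by
  induction l with
  | nil => exact base one_mem_klein
  | cons g l ih =>
    rw [List.prod_cons, List.length_cons, Nat.mul_succ, Nat.add_comm]
    exact (h g (by simp)).mul (ih fun g' hg' => h g' (by simp [hg']))

theorem finite (k : ℕ) : {g | AltLen k g}.Finite := by
  have hk : klein.Finite := by unfold klein; exact Set.toFinite _
  induction k with
  | zero =>
    refine hk.subset fun g hg => ?_
    cases hg with
    | base hv => exact hv
  | succ k ih =>
    refine (hk.union ((hk.prod ih).image fun p => p.1 * KV.gen 0 * p.2)).subset fun g hg => ?_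
    cases hg with
    | base hv => exact Or.inl hv
    | step hv hh => exact Or.inr ⟨(_, _), ⟨hv, hh⟩, rfl⟩

end AltLen

end KV

open KV

/-! ### Sections and the action on the tree -/

/-- The permutation of `X` induced by an element of `⟨a, b, c, d⟩`: the parity of the number of
letters `a`. -/
def rot : KV →* Equiv.Perm X :=
  KV.lift ![Equiv.swap 0 1, 1, 1, 1]
    (by decide) (by decide)

/-- The entries `a_{β(i)}, a_{γ(i)}, a_{δ(i)}` of `b, c, d` at the vertex `0`, as elements of
`⟨a, b, c, d⟩`. -/
def leftEntry (i : Fin 3) : Fin 4 → KV :=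
  ![1, ![gen 0, gen 0, 1] i, ![gen 0, 1, gen 0] i, ![1, gen 0, gen 0] i]

theorem leftEntry_cases (i : Fin 3) (j : Fin 4) : leftEntry i j = 1 ∨ leftEntry i j = gen 0 := by
  fin_cases i <;> fin_cases j <;> simp [leftEntry]

/-- The decomposition `g ↦ (g_0, g_1) σ` of the elements of `⟨a, b, c, d⟩`, according to the first
letter `i` of `ω`. The left component at `y` is the section of `g` at the vertex which `g` moves to
`y`. -/
def decomp (i : Fin 3) :
    KV →* (X → KV) ⋊[mulAutArrow (G := Equiv.Perm X) (A := X) (M := KV)] Equiv.Perm X :=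
  KV.lift ![⟨1, Equiv.swap 0 1⟩, ⟨![leftEntry i 1, gen 1], 1⟩, ⟨![leftEntry i 2, gen 2], 1⟩,
      ⟨![leftEntry i 3, gen 3], 1⟩]
    (by
      intro j
      fin_cases j <;> fin_cases i <;> refine SemidirectProduct.ext ?_ ?_ <;>
        simp [leftEntry] <;> ext k <;> fin_cases k <;> simp [gen_mul_self])
    (by
      fin_cases i <;> refine SemidirectProduct.ext ?_ ?_ <;>
        simp [leftEntry] <;> ext k <;> fin_cases k <;> simp [gen_mul_self, gen_one_mul_gen_two])

theorem decomp_right (i : Fin 3) (g : KV) : (decomp i g).right = rot g := by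
  have : (SemidirectProduct.rightHom.comp (decomp i)) = rot := KV.hom_ext fun j => by
    fin_cases j <;> simp [decomp, rot]
  exact DFunLike.congr_fun this g

/-- The section of `g` at the vertex `x` of the first level. -/
def sec1 (i : Fin 3) (x : X) (g : KV) : KV := (decomp i g).left (rot g x)

theorem sec1_one (i : Fin 3) (x : X) : sec1 i x 1 = 1 := by simp [sec1]

theorem sec1_mul (i : Fin 3) (x : X) (g h : KV) :
    sec1 i x (g * h) = sec1 i (rot h x) g * sec1 i x h := by
  simp only [sec1, map_mul, SemidirectProduct.mul_left, decomp_right, Pi.mul_apply,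
    Equiv.Perm.mul_apply]
  congr 1
  exact congrArg (decomp i h).left ((rot g).symm_apply_apply (rot h x))

theorem sec1_gen_zero (i : Fin 3) (x : X) : sec1 i x (gen 0) = 1 := by
  simp [sec1, decomp]

theorem rot_gen_zero (x : X) : rot (gen 0) x = 1 - x := by
  fin_cases x <;> simp [rot]

theorem rot_klein {v : KV} (hv : v ∈ klein) (x : X) : rot v x = x := by
  rcases hv with rfl | rfl | rfl | rfl <;> simp [rot]

theorem sec1_zero_gen (i : Fin 3) {j : Fin 4} : sec1 i 0 (gen j) = leftEntry i j := by
  fin_cases j <;> simp [sec1, decomp, rot, leftEntry]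

theorem sec1_one_gen (i : Fin 3) {j : Fin 4} (hj : j ≠ 0) : sec1 i 1 (gen j) = gen j := by
  fin_cases j <;> simp [sec1, decomp, rot] at hj ⊢

theorem sec1_one_klein (i : Fin 3) {v : KV} (hv : v ∈ klein) : sec1 i 1 v = v := by
  rcases hv with rfl | rfl | rfl | rfl
  · exact sec1_one _ _
  all_goals exact sec1_one_gen i (by decide)

theorem sec1_zero_klein (i : Fin 3) {v : KV} (hv : v ∈ klein) :
    sec1 i 0 v = 1 ∨ sec1 i 0 v = gen 0 := by
  rcases hv with rfl | rfl | rfl | rfl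
  · exact Or.inl (sec1_one _ _)
  all_goals rw [sec1_zero_gen]; exact leftEntry_cases i _

/-- The section of `g` at the vertex `v` of the tree. -/
def sec : Om → List X → KV → KV
  | _, [], g => g
  | ω, x :: v, g => sec (shift ω) v (sec1 (ω 0) x g)

theorem eq_zero_or_one (x : X) : x = 0 ∨ x = 1 := by
  revert x; decide

theorem a_mul_self : a * a = 1 :=
  Subtype.ext (Equiv.ext flipFun_flipFun)

theorem spineFun_mul (s t : Fin 3 → TreeAut) :
    ∀ (ω : Om) (v : List X), spineFun s ω (spineFun t ω v) = spineFun (s * t) ω v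
  | _, [] => rfl
  | ω, 0 :: v => by simp [spineFun]
  | ω, 1 :: v => by simp [spineFun, spineFun_mul s t (shift ω) v]

theorem spine_mul (s t : Fin 3 → TreeAut) (ω : Om) : spine s ω * spine t ω = spine (s * t) ω :=
  Subtype.ext (Equiv.ext (spineFun_mul s t ω))

theorem spineFun_one : ∀ (ω : Om) (v : List X), spineFun 1 ω v = v
  | _, [] => rfl
  | ω, 0 :: v => by simp [spineFun]
  | ω, 1 :: v => by simp [spineFun, spineFun_one (shift ω) v]

theorem spine_one (ω : Om) : spine 1 ω = 1 := Subtype.ext (Equiv.ext (spineFun_one ω))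

/-- The action on the tree of the group `⟨a, b, c, d ∣ a², b², c², d², bcd⟩` through `G_ω`. -/
def tree (ω : Om) : KV →* TreeAut :=
  KV.lift (S ω)
    (by
      intro i
      fin_cases i
      · exact a_mul_self
      all_goals
        refine (spine_mul _ _ ω).trans ?_
        convert spine_one ω
        ext1 k
        fin_cases k <;> simp [a_mul_self])
    (by
      change spine _ ω * spine _ ω * spine _ ω = 1
      rw [spine_mul, spine_mul]
      convert spine_one ω
      ext1 k
      fin_cases k <;> simp [a_mul_self])

theorem tree_gen (ω : Om) (i : Fin 4) : tree ω (gen i) = S ω i := KV.lift_gen _ _ _ i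

theorem tree_nil (ω : Om) (g : KV) : (tree ω g).1 [] = [] := apply_nil_of_mem (tree ω g).2

theorem tree_mul_apply (ω : Om) (g h : KV) (v : List X) :
    (tree ω (g * h)).1 v = (tree ω g).1 ((tree ω h).1 v) := by
  rw [map_mul]; rfl

theorem tree_one_apply (ω : Om) (v : List X) : (tree ω 1).1 v = v := by
  rw [map_one]; rfl

theorem tree_leftEntry (ω : Om) (i : Fin 3) (j : Fin 4) :
    tree ω (leftEntry i j) = ![1, ![a, a, 1] i, ![a, 1, a] i, ![1, a, a] i] j := by
  have h : tree ω (gen 0) = a := tree_gen ω 0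
  fin_cases i <;> fin_cases j <;> first | exact map_one _ | exact h

theorem tree_cons_gen (ω : Om) (i : Fin 4) (x : X) (v : List X) :
    (tree ω (gen i)).1 (x :: v) =
      rot (gen i) x :: (tree (shift ω) (sec1 (ω 0) x (gen i))).1 v := by
  rw [tree_gen]
  by_cases hi : i = 0
  · subst hi
    rw [sec1_gen_zero, rot_gen_zero, tree_one_apply]
    fin_cases x <;> rfl
  · have hx : rot (gen i) x = x := rot_klein (by fin_cases i <;> simp [klein] at hi ⊢) x
    rw [hx]
    obtain rfl | rfl := eq_zero_or_one x
    · rw [sec1_zero_gen, tree_leftEntry]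
      fin_cases i
      · exact absurd rfl hi
      all_goals rfl
    · rw [sec1_one_gen _ hi, tree_gen]
      fin_cases i
      · exact absurd rfl hi
      all_goals rfl

/-- The recursion `g (x v) = (σ x) (g_x v)` for the action on the tree. -/
theorem tree_cons (ω : Om) (g : KV) (x : X) (v : List X) :
    (tree ω g).1 (x :: v) = rot g x :: (tree (shift ω) (sec1 (ω 0) x g)).1 v := by
  induction g using KV.induction with
  | one => simp [sec1_one]
  | gen_mul i g ih =>
    rw [tree_mul_apply, ih, tree_cons_gen, sec1_mul, tree_mul_apply, map_mul]; rfl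

theorem length_tree (ω : Om) (g : KV) (v : List X) : ((tree ω g).1 v).length = v.length := by
  induction v generalizing ω g with
  | nil => rw [tree_nil]
  | cons x v ih => rw [tree_cons, List.length_cons, ih, List.length_cons]

theorem sec_one (ω : Om) (v : List X) : sec ω v 1 = 1 := by
  induction v generalizing ω with
  | nil => rfl
  | cons x v ih => rw [sec, sec1_one, ih]

theorem sec_mul (ω : Om) (v : List X) (g h : KV) :
    sec ω v (g * h) = sec ω ((tree ω h).1 v) g * sec ω v h := by
  induction v generalizing ω g h with
  | nil => rw [tree_nil]; rfl
  | cons x v ih => rw [tree_cons]; simp only [sec]; rw [sec1_mul, ih]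

theorem tree_append (ω : Om) (v w : List X) (g : KV) :
    (tree ω g).1 (v ++ w) = (tree ω g).1 v ++ (tree (shift^[v.length] ω) (sec ω v g)).1 w := by
  induction v generalizing ω g with
  | nil => rw [tree_nil]; rfl
  | cons x v ih =>
    rw [List.cons_append, tree_cons, tree_cons, ih, List.length_cons, iterate_succ_apply]
    rfl

theorem sec_append (ω : Om) (v w : List X) (g : KV) :
    sec ω (v ++ w) g = sec (shift^[v.length] ω) w (sec ω v g) := by
  induction v generalizing ω g with
  | nil => rfl
  | cons x v ih => exact ih _ _

theorem sec_congr {ω ω' : Om} {v : List X} (h : ∀ k < v.length, ω k = ω' k) (g : KV) :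
    sec ω v g = sec ω' v g := by
  induction v generalizing ω ω' g with
  | nil => rfl
  | cons x v ih =>
    simp only [sec]
    rw [h 0 (by simp), ih (ω := shift ω) (ω' := shift ω') fun k hk => h (k + 1) (by simpa using hk)]

theorem tree_congr {ω ω' : Om} {v : List X} (h : ∀ k < v.length, ω k = ω' k) (g : KV) :
    (tree ω g).1 v = (tree ω' g).1 v := by
  induction v generalizing ω ω' g with
  | nil => rw [tree_nil, tree_nil]
  | cons x v ih =>
    rw [tree_cons, tree_cons, h 0 (by simp),
      ih (ω := shift ω) (ω' := shift ω') fun k hk => h (k + 1) (by simpa using hk)]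

/-- An element acts trivially if it fixes a level of the tree and all its sections on this level
act trivially. -/
theorem tree_eq_one {ω : Om} {n : ℕ} {g : KV}
    (h : ∀ v : List X, v.length = n → (tree ω g).1 v = v ∧ tree (shift^[n] ω) (sec ω v g) = 1) :
    tree ω g = 1 := by
  refine Subtype.ext (Equiv.ext fun w => ?_)
  change (tree ω g).1 w = w
  rcases le_or_gt n w.length with hw | hw
  · have hl : (w.take n).length = n := by simpa using hw
    obtain ⟨h1, h2⟩ := h _ hl
    conv_lhs => rw [← List.take_append_drop n w]
    rw [tree_append, h1, hl, h2]
    exact List.take_append_drop n w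
  · -- A word shorter than `n` is a prefix of a word of length `n`.
    have hl : (w ++ List.replicate (n - w.length) 0).length = n := by
      rw [List.length_append, List.length_replicate]; omega
    have h1 := (h _ hl).1
    rw [tree_append] at h1
    exact List.append_inj_left h1 (length_tree ω g w)

/-- The stabilizer of the vertex `v` in the action through `G_ω`. -/
def vertexStab (ω : Om) (v : List X) : Subgroup KV :=
  (MulAction.stabilizer (Equiv.Perm (List X)) v).comap (TreeAut.subtype.comp (tree ω))

theorem mem_vertexStab {ω : Om} {v : List X} {g : KV} :
    g ∈ vertexStab ω v ↔ (tree ω g).1 v = v := Iff.rfl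

instance (ω : Om) (v : List X) : (vertexStab ω v).FiniteIndex := by
  let _ : MulAction KV (List X) := MulAction.compHom _ (TreeAut.subtype.comp (tree ω))
  have h : vertexStab ω v = MulAction.stabilizer KV v := rfl
  have hfin : (MulAction.orbit KV v).Finite := by
    refine (List.finite_length_eq X v.length).subset ?_
    rintro _ ⟨g, rfl⟩
    exact length_tree ω g v
  refine ⟨?_⟩
  rw [h, MulAction.index_stabilizer]
  exact (Set.ncard_pos hfin).2 ⟨v, MulAction.mem_orbit_self v⟩ |>.ne'

/-- The section at a vertex, as a homomorphism on the stabilizer of the vertex. -/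
def secHom (ω : Om) (v : List X) : vertexStab ω v →* KV where
  toFun g := sec ω v g.1
  map_one' := sec_one ω v
  map_mul' g h := by
    rw [Subgroup.coe_mul, sec_mul, mem_vertexStab.1 h.2]

theorem exists_sec1_eq (i : Fin 3) (g : KV) : ∃ h, rot h 1 = 1 ∧ sec1 i 1 h = g := by
  have ha : ∃ h, rot h 1 = 1 ∧ sec1 i 1 h = gen 0 := by
    -- One of `aba`, `aca` has section `a` at `1`, since `β(i) = a` or `γ(i) = a`.
    have key : ∀ j : Fin 4, j ≠ 0 → leftEntry i j = gen 0 →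
        ∃ h, rot h 1 = 1 ∧ sec1 i 1 h = gen 0 := by
      intro j hj hij
      refine ⟨gen 0 * (gen j * gen 0), ?_, ?_⟩
      · have := rot_klein (v := gen j) (by fin_cases j <;> simp [klein] at hj ⊢) 0
        simp [rot_gen_zero, this]
      · have := rot_gen_zero 1
        rw [sec1_mul, sec1_gen_zero, sec1_mul, this, sub_self, sec1_zero_gen, hij, sec1_gen_zero,
          one_mul, mul_one]
    fin_cases i
    · exact key 1 (by decide) rfl
    · exact key 1 (by decide) rfl
    · exact key 2 (by decide) rfl
  induction g using KV.induction with
  | one => exact ⟨1, by simp, sec1_one _ _⟩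
  | gen_mul j g ih =>
    obtain ⟨h, h1, hg⟩ := ih
    obtain ⟨u, u1, hu⟩ : ∃ u, rot u 1 = 1 ∧ sec1 i 1 u = gen j := by
      by_cases hj : j = 0
      · rw [hj]; exact ha
      · exact ⟨gen j, rot_klein (by fin_cases j <;> simp [klein] at hj ⊢) 1, sec1_one_gen i hj⟩
    exact ⟨u * h, by simp [h1, u1], by rw [sec1_mul, h1, hu, hg]⟩

theorem secHom_replicate_surjective (ω : Om) (n : ℕ) :
    Surjective (secHom ω (List.replicate n 1)) := by
  suffices H : ∀ g, ∃ h, (tree ω h).1 (List.replicate n 1) = List.replicate n 1 ∧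
      sec ω (List.replicate n 1) h = g from fun g =>
    let ⟨h, h1, h2⟩ := H g
    ⟨⟨h, h1⟩, h2⟩
  intro g
  induction n generalizing ω g with
  | zero => exact ⟨g, tree_nil _ _, rfl⟩
  | succ n ih =>
    obtain ⟨h, h1, h2⟩ := ih (shift ω) g
    obtain ⟨u, u1, hu⟩ := exists_sec1_eq (ω 0) h
    refine ⟨u, ?_, ?_⟩
    · rw [List.replicate_succ, tree_cons, u1, hu, h1]
    · rw [List.replicate_succ, sec, hu, h2]

/-! ### Contraction -/

theorem sec1_klein (i : Fin 3) (x : X) {v : KV} (hv : v ∈ klein) : AltLen 1 (sec1 i x v) := by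
  obtain rfl | rfl := eq_zero_or_one x
  · rcases sec1_zero_klein i hv with h | h <;> rw [h]
    · exact .base one_mem_klein
    · exact .gen_zero
  · rw [sec1_one_klein i hv]
    exact .base hv

theorem sec1_klein_mul_sec1_klein (i : Fin 3) (x : X) {v w : KV} (hv : v ∈ klein)
    (hw : w ∈ klein) : AltLen 1 (sec1 i (1 - x) v * sec1 i x w) := by
  obtain rfl | rfl := eq_zero_or_one x
  · rw [sub_zero, sec1_one_klein i hv]
    exact (sec1_klein i 0 hw).klein_mul hv
  · rw [sub_self, sec1_one_klein i hw]
    exact (sec1_klein i 0 hv).mul (.base (k := 0) hw)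

theorem sec1_mul_gen_zero_mul (i : Fin 3) (x : X) (v g : KV) :
    sec1 i x (v * gen 0 * g) = sec1 i (1 - rot g x) v * sec1 i x g := by
  rw [mul_assoc, sec1_mul, sec1_mul, sec1_gen_zero, one_mul, map_mul, Equiv.Perm.mul_apply,
    rot_gen_zero]

/-- Passing to a section halves the number of letters `a`: in `v₀ a v₁ a v₂ ⋯`, every other `vᵢ`
contributes an element of `{1, b, c, d}` and the remaining ones contribute `1` or `a`. -/
theorem KV.AltLen.sec1 (i : Fin 3) (x : X) {k : ℕ} {g : KV} (h : AltLen k g) :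
    AltLen (k / 2 + 1) (sec1 i x g) := by
  induction k using Nat.strong_induction_on generalizing g with
  | _ k ih =>
    cases h with
    | base hv => exact (sec1_klein i x hv).mono (Nat.le_add_left _ _)
    | step hv hh =>
      rw [sec1_mul_gen_zero_mul i x]
      cases hh with
      | base hw =>
        rw [rot_klein hw]
        exact (sec1_klein_mul_sec1_klein i x hv hw).mono (Nat.le_add_left _ _)
      | @step k w h hw hh =>
        have hr : rot (w * KV.gen 0 * h) x = 1 - rot h x := by
          rw [mul_assoc, map_mul, Equiv.Perm.mul_apply, rot_klein hw, map_mul,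
            Equiv.Perm.mul_apply, rot_gen_zero]
        rw [sec1_mul_gen_zero_mul i x, ← mul_assoc, hr]
        refine ((sec1_klein_mul_sec1_klein i (1 - rot h x) hv hw).mul
          (ih k (by omega) hh)).mono ?_
        omega

theorem sec_induction {P : KV → Prop} (hP : ∀ i x g, P g → P (sec1 i x g)) (ω : Om) (v : List X)
    {g : KV} (hg : P g) : P (sec ω v g) := by
  induction v generalizing ω g with
  | nil => exact hg
  | cons x v ih => exact ih _ (hP _ _ _ hg)

theorem KV.AltLen.sec {n : ℕ} (ω : Om) {v : List X} (hv : n < v.length) {g : KV}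
    (hg : AltLen (2 ^ n + 2) g) : AltLen 2 (sec ω v g) := by
  induction n generalizing ω v g with
  | zero =>
    obtain ⟨x, v, rfl⟩ := List.exists_cons_of_length_pos hv
    exact sec_induction (fun i x g hg => hg.sec1 i x) _ v (hg.sec1 (ω 0) x)
  | succ n ih =>
    obtain ⟨x, v, rfl⟩ := List.exists_cons_of_length_pos (Nat.zero_lt_of_lt hv)
    refine ih _ (Nat.lt_of_succ_lt_succ hv) ((hg.sec1 (ω 0) x).mono ?_)
    rw [pow_succ]; omega

/-- The subgroup `{1, a}`, as a set. -/
def flips : Set KV := {1, gen 0}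

theorem one_mem_flips : (1 : KV) ∈ flips := Or.inl rfl

theorem sec1_flips (i : Fin 3) (x : X) {s : KV} (hs : s ∈ flips) : sec1 i x s = 1 := by
  rcases hs with rfl | rfl
  · exact sec1_one i x
  · exact sec1_gen_zero i x

/-- The nucleus `{1, a, b, c, d}`. -/
def nucleus : Set KV := flips ∪ klein

theorem sec1_klein_mem_nucleus (i : Fin 3) (x : X) {v : KV} (hv : v ∈ klein) :
    sec1 i x v ∈ nucleus := by
  obtain rfl | rfl := eq_zero_or_one x
  · exact Or.inl (sec1_zero_klein i hv)
  · rw [sec1_one_klein i hv]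
    exact Or.inr hv

/-- The elements `s v t` with `s, t ∈ {1, a}` and `v ∈ {1, b, c, d}`. -/
def flipKleinFlip : Set KV := {g | ∃ s ∈ flips, ∃ v ∈ klein, ∃ t ∈ flips, g = s * v * t}

theorem nucleus_subset_flipKleinFlip : nucleus ⊆ flipKleinFlip := by
  rintro g (hg | hg)
  · exact ⟨g, hg, 1, one_mem_klein, 1, one_mem_flips, by simp⟩
  · exact ⟨1, one_mem_flips, g, hg, 1, one_mem_flips, by simp⟩

theorem sec1_flipKleinFlip (i : Fin 3) (x : X) {g : KV} (hg : g ∈ flipKleinFlip) :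
    sec1 i x g ∈ nucleus := by
  obtain ⟨s, hs, v, hv, t, ht, rfl⟩ := hg
  rw [sec1_mul, sec1_mul, sec1_flips i _ hs, sec1_flips i _ ht, one_mul, mul_one]
  exact sec1_klein_mem_nucleus i _ hv

theorem sec1_klein_mul_gen_zero_mul_klein (i : Fin 3) (x : X) {v w : KV} (hv : v ∈ klein)
    (hw : w ∈ klein) : sec1 i x (v * gen 0 * w) ∈ flipKleinFlip := by
  rw [sec1_mul_gen_zero_mul i x, rot_klein hw]
  obtain rfl | rfl := eq_zero_or_one x
  · rw [sub_zero, sec1_one_klein i hv]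
    exact ⟨1, one_mem_flips, v, hv, _, sec1_zero_klein i hw, by simp⟩
  · rw [sub_self, sec1_one_klein i hw]
    exact ⟨_, sec1_zero_klein i hv, w, hw, 1, one_mem_flips, by simp⟩

theorem sec1_sec1_of_altLen_two (i j : Fin 3) (x y : X) {g : KV} (hg : AltLen 2 g) :
    sec1 j y (sec1 i x g) ∈ flipKleinFlip := by
  have key : ∀ {h}, h ∈ flipKleinFlip → sec1 j y h ∈ flipKleinFlip := fun hh =>
    nucleus_subset_flipKleinFlip (sec1_flipKleinFlip j y hh)
  cases hg with
  | base hv => exact key (nucleus_subset_flipKleinFlip (sec1_klein_mem_nucleus i x hv))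
  | @step _ u h hu hh =>
    cases hh with
    | base hv => exact key (sec1_klein_mul_gen_zero_mul_klein i x hu hv)
    | @step _ v h hv hh =>
      cases hh with
      | base hw =>
        have hr : rot (v * gen 0 * h) x = 1 - x := by
          simp [rot_klein hv, rot_klein hw, rot_gen_zero]
        rw [sec1_mul_gen_zero_mul i x, sec1_mul_gen_zero_mul i x, hr,
          rot_klein hw, sub_sub_cancel]
        obtain rfl | rfl := eq_zero_or_one x
        · rw [sub_zero, sec1_one_klein i hv, ← mul_assoc]
          exact key ⟨_, sec1_zero_klein i hu, v, hv, _, sec1_zero_klein i hw, rfl⟩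
        · rw [sub_self, sec1_one_klein i hu, sec1_one_klein i hw, ← mul_assoc]
          rcases sec1_zero_klein i hv with h | h <;> rw [h]
          · rw [mul_one]
            exact nucleus_subset_flipKleinFlip
              (sec1_klein_mem_nucleus j y (mul_mem_klein hu hw))
          · exact sec1_klein_mul_gen_zero_mul_klein j y hu hw

theorem sec_mem_nucleus_of_altLen_two (ω : Om) {v : List X} (hv : 3 ≤ v.length) {g : KV}
    (hg : AltLen 2 g) : sec ω v g ∈ nucleus := by
  match v, hv with
  | x :: y :: z :: v, _ =>
    exact sec_induction (fun i x g hg => sec1_flipKleinFlip i x (nucleus_subset_flipKleinFlip hg))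
      _ v (sec1_flipKleinFlip _ z (sec1_sec1_of_altLen_two _ _ x y hg))

theorem exists_sec_mem_nucleus (g : KV) :
    ∃ n, ∀ (ω : Om) (v : List X), n ≤ v.length → sec ω v g ∈ nucleus := by
  obtain ⟨k, hk⟩ := AltLen.exists_altLen g
  refine ⟨k + 4, fun ω v hv => ?_⟩
  have hk' : AltLen (2 ^ k + 2) g := hk.mono (by have := Nat.lt_two_pow_self (n := k); omega)
  rw [← List.take_append_drop (k + 1) v, sec_append]
  refine sec_mem_nucleus_of_altLen_two _ ?_ (hk'.sec ω ?_)
  · rw [List.length_drop]; omega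
  · rw [List.length_take]; omega

/-! ### Elements acting trivially -/

theorem a_ne_one : a ≠ 1 := fun h => by
  have := congrArg (fun g : TreeAut => g.1 [0]) h
  exact absurd this (by decide)

theorem apply_eq_one_of_spine_eq_one {s : Fin 3 → TreeAut} {ω : Om} (h : spine s ω = 1) (n : ℕ) :
    s (ω n) = 1 := by
  have hs : ∀ v, spineFun s ω v = v := fun v => congrArg (fun g : TreeAut => g.1 v) h
  induction n generalizing ω with
  | zero => exact Subtype.ext (Equiv.ext fun v => (List.cons.inj (hs (0 :: v))).2)
  | succ n ih =>
    have hs' : ∀ v, spineFun s (shift ω) v = v := fun v => (List.cons.inj (hs (1 :: v))).2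
    exact ih (ω := shift ω) (Subtype.ext (Equiv.ext hs')) hs'

theorem tree_gen_ne_one {ω : Om} (hω : ω ∈ OmPlus) {j : Fin 4} (hj : j ≠ 0) :
    tree ω (gen j) ≠ 1 := by
  intro h
  rw [tree_gen] at h
  -- The sequence `ω` would be constant, equal to `2`, `1` or `0`.
  have key : ∀ (s : Fin 3 → TreeAut) (i : Fin 3), (∀ k ≠ i, s k = a) → spine s ω ≠ 1 :=
    fun s i hi hsp => hω ⟨i, 0, fun n _ => by_contra fun hn =>
      a_ne_one ((hi _ hn).symm.trans (apply_eq_one_of_spine_eq_one hsp n))⟩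
  fin_cases j
  · exact hj rfl
  · exact key ![a, a, 1] 2 (by intro k hk; fin_cases k <;> simp at hk ⊢) h
  · exact key ![a, 1, a] 1 (by intro k hk; fin_cases k <;> simp at hk ⊢) h
  · exact key ![1, a, a] 0 (by intro k hk; fin_cases k <;> simp at hk ⊢) h

theorem eq_one_of_tree_eq_one_of_mem_nucleus {ω : Om} (hω : ω ∈ OmPlus) {g : KV}
    (hg : g ∈ nucleus) (h : tree ω g = 1) : g = 1 := by
  rcases hg with (rfl | rfl) | (rfl | rfl | rfl | rfl)
  · rfl
  · rw [tree_gen] at h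
    exact absurd h a_ne_one
  · rfl
  all_goals exact absurd h (tree_gen_ne_one hω (by decide))

theorem iterate_shift_apply (ω : Om) (n k : ℕ) : (shift^[n] ω) k = ω (k + n) := by
  induction n generalizing ω with
  | zero => rfl
  | succ n ih => rw [iterate_succ_apply, ih]; rfl

theorem iterate_shift_mem_omPlus {ω : Om} (hω : ω ∈ OmPlus) (n : ℕ) : shift^[n] ω ∈ OmPlus := by
  rintro ⟨x, N, h⟩
  refine hω ⟨x, N + n, fun k hk => ?_⟩
  have := h (k - n) (by omega)
  rwa [iterate_shift_apply, Nat.sub_add_cancel (by omega)] at this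

/-- If `ω` is not eventually constant, an element which acts trivially through `G_ω` becomes
trivial in `⟨a, b, c, d ∣ a², b², c², d², bcd⟩` on passing to sections on a deep level. -/
theorem exists_sec_eq_one {ω : Om} (hω : ω ∈ OmPlus) {g : KV} (h : tree ω g = 1) :
    ∃ n, ∀ v : List X, n ≤ v.length → sec ω v g = 1 := by
  obtain ⟨n, hn⟩ := exists_sec_mem_nucleus g
  refine ⟨n, fun v hv => eq_one_of_tree_eq_one_of_mem_nucleus
    (iterate_shift_mem_omPlus hω v.length) (hn ω v hv) ?_⟩
  refine Subtype.ext (Equiv.ext fun w => ?_)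
  have h1 := tree_append ω v w g
  rw [h] at h1
  exact (List.append_cancel_left h1).symm

/-! ### Largeness of `⟨a, b, c, d ∣ a², b², c², d², bcd⟩` -/

/-- The endomorphism of the free group on `Fin 4` which permutes the generators by `c.1` and
inverts all of them if `c.2 = -1`. -/
def signedHom (c : Equiv.Perm (Fin 4) × ℤˣ) : FreeGroup (Fin 4) →* FreeGroup (Fin 4) :=
  FreeGroup.lift fun i => FreeGroup.of (c.1 i) ^ (c.2 : ℤ)

theorem signedHom_of (c : Equiv.Perm (Fin 4) × ℤˣ) (i : Fin 4) :
    signedHom c (FreeGroup.of i) = FreeGroup.of (c.1 i) ^ (c.2 : ℤ) :=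
  FreeGroup.lift_apply_of

theorem signedHom_mul (c c' : Equiv.Perm (Fin 4) × ℤˣ) (w : FreeGroup (Fin 4)) :
    signedHom (c * c') w = signedHom c (signedHom c' w) := by
  have : signedHom (c * c') = (signedHom c).comp (signedHom c') := by
    ext i
    simp [signedHom_of, zpow_mul]
  rw [this]; rfl

theorem signedHom_one (w : FreeGroup (Fin 4)) : signedHom 1 w = w := by
  have : signedHom 1 = MonoidHom.id _ := by
    ext i
    simp [signedHom_of]
  rw [this]; rfl

/-- The action of signed permutations on the free group on `Fin 4`. -/
def signedAut : Equiv.Perm (Fin 4) × ℤˣ →* MulAut (FreeGroup (Fin 4)) where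
  toFun c :=
    { signedHom c with
      invFun := signedHom c⁻¹
      left_inv := fun w => by
        change signedHom c⁻¹ (signedHom c w) = w
        rw [← signedHom_mul, inv_mul_cancel, signedHom_one]
      right_inv := fun w => by
        change signedHom c (signedHom c⁻¹ w) = w
        rw [← signedHom_mul, mul_inv_cancel, signedHom_one] }
  map_one' := MulEquiv.ext signedHom_one
  map_mul' c c' := MulEquiv.ext (signedHom_mul c c')

theorem signedAut_apply (c : Equiv.Perm (Fin 4) × ℤˣ) (w : FreeGroup (Fin 4)) :
    signedAut c w = signedHom c w := rfl

/-- The homomorphism to a virtually free group which sends `b, c, d` to the double transpositions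
in `Fin 4`, and `a` to the product of the generator `0` and the inversion of all generators. -/
def toVirtuallyFree : KV →* FreeGroup (Fin 4) ⋊[signedAut] (Equiv.Perm (Fin 4) × ℤˣ) :=
  KV.lift ![⟨FreeGroup.of 0, 1, -1⟩, ⟨1, Equiv.swap 0 1 * Equiv.swap 2 3, 1⟩,
      ⟨1, Equiv.swap 0 2 * Equiv.swap 1 3, 1⟩, ⟨1, Equiv.swap 0 3 * Equiv.swap 1 2, 1⟩]
    (by
      intro i
      refine SemidirectProduct.ext ?_ ?_
      · fin_cases i <;> simp [signedAut_apply, signedHom_of]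
      · fin_cases i <;> decide)
    (by
      refine SemidirectProduct.ext ?_ ?_
      · simp
      · decide)

theorem large_KV : Large KV := by
  let r := SemidirectProduct.rightHom.comp toVirtuallyFree
  have hr : ∀ g : r.ker, (toVirtuallyFree g.1).right = 1 := fun g => g.2
  let t : r.ker →* FreeGroup (Fin 4) :=
    { toFun := fun g => (toVirtuallyFree g.1).left
      map_one' := by simp
      map_mul' := fun g h => by
        rw [Subgroup.coe_mul, map_mul, SemidirectProduct.mul_left, hr g, map_one]; rfl }
  -- The elements `(ab)²` and `(ac)²` are mapped to `x₀ x₁⁻¹` and `x₀ x₂⁻¹`.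
  have h1 : (gen 0 * gen 1) * (gen 0 * gen 1) ∈ r.ker := by
    rw [MonoidHom.mem_ker]
    simp only [r, map_mul, MonoidHom.comp_apply, toVirtuallyFree, KV.lift_gen]
    decide
  have h2 : (gen 0 * gen 2) * (gen 0 * gen 2) ∈ r.ker := by
    rw [MonoidHom.mem_ker]
    simp only [r, map_mul, MonoidHom.comp_apply, toVirtuallyFree, KV.lift_gen]
    decide
  refine large_of_not_commute r.ker t (x := ⟨_, h1⟩) (y := ⟨_, h2⟩) fun h => ?_
  have e1 : t ⟨_, h1⟩ = FreeGroup.of 0 * (FreeGroup.of 1)⁻¹ := by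
    simp [t, toVirtuallyFree, signedAut_apply, signedHom_of]
    exact congrArg FreeGroup.of (by decide)
  have e2 : t ⟨_, h2⟩ = FreeGroup.of 0 * (FreeGroup.of 2)⁻¹ := by
    simp [t, toVirtuallyFree, signedAut_apply, signedHom_of]
    exact congrArg FreeGroup.of (by decide)
  rw [e1, e2] at h
  exact absurd h.eq (by decide)

/-! ### Finitely presented covers -/

/-- The elements which fix the level `n` of the tree and whose sections on this level are trivial
in `⟨a, b, c, d ∣ a², b², c², d², bcd⟩`. -/
def deepKer (ω : Om) (n : ℕ) : Subgroup KV where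
  carrier := {g | ∀ v : List X, v.length = n → (tree ω g).1 v = v ∧ sec ω v g = 1}
  one_mem' := fun v _ => ⟨tree_one_apply ω v, sec_one ω v⟩
  mul_mem' := fun {g h} hg hh v hv => by
    obtain ⟨h1, h2⟩ := hh v hv
    obtain ⟨g1, g2⟩ := hg v hv
    exact ⟨by rw [tree_mul_apply, h1, g1], by rw [sec_mul, h1, g2, h2, one_mul]⟩
  inv_mem' := fun {g} hg v hv => by
    obtain ⟨g1, g2⟩ := hg v hv
    have h1 : (tree ω g⁻¹).1 v = v := by
      conv_lhs => rw [← g1]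
      rw [← tree_mul_apply, inv_mul_cancel, tree_one_apply]
    have h2 := sec_mul ω v g⁻¹ g
    rw [inv_mul_cancel, sec_one, g1, g2, mul_one] at h2
    exact ⟨h1, h2.symm⟩

instance (ω : Om) (n : ℕ) : (deepKer ω n).Normal where
  conj_mem g hg h := by
    intro v hv
    obtain ⟨g1, g2⟩ := hg ((tree ω h⁻¹).1 v) ((length_tree _ _ _).trans hv)
    constructor
    · rw [tree_mul_apply, tree_mul_apply, g1, ← tree_mul_apply, mul_inv_cancel, tree_one_apply]
    · rw [sec_mul, sec_mul, g1, g2, mul_one, ← sec_mul, mul_inv_cancel, sec_one]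

theorem eventually_mem_deepKer {ω : Om} (hω : ω ∈ OmPlus) {g : KV} (h : tree ω g = 1) :
    ∀ᶠ n in Filter.atTop, g ∈ deepKer ω n := by
  obtain ⟨n, hn⟩ := exists_sec_eq_one hω h
  filter_upwards [Filter.eventually_ge_atTop n] with m hm v hv
  exact ⟨by rw [h]; rfl, hn v (hv ▸ hm)⟩

/-- Finitely presented covers of `G_ω` are large. The finitely many relators are already trivial
modulo some `deepKer ω n`, hence the cover maps onto the quotient by `deepKer ω n`, which has a
finite index subgroup that maps onto the large group `⟨a, b, c, d ∣ a², b², c², d², bcd⟩`. -/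
theorem large_of_range_eq {ω : Om} (hω : ω ∈ OmPlus) {E : Type*} [Group E]
    [hE : Group.IsFinitelyPresented E] (θ : E →* TreeAut) (hθ : θ.range = (tree ω).range) :
    Large E := by
  obtain ⟨m, π, hπ, R, hR, hker⟩ := hE.out
  have hlift : ∀ e, ∃ g, tree ω g = θ e := fun e => by
    have : θ e ∈ (tree ω).range := hθ ▸ ⟨e, rfl⟩
    exact this
  choose lft hlft using hlift
  let l : FreeGroup (Fin m) →* KV := FreeGroup.lift fun i => lft (π (FreeGroup.of i))
  have hl : ∀ w, tree ω (l w) = θ (π w) := by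
    have : (tree ω).comp l = θ.comp π := by
      ext1 i
      simp [l, hlft]
    exact fun w => DFunLike.congr_fun this w
  have hgen : ∀ j, ∃ w, θ (π w) = tree ω (gen j) := fun j => by
    have : tree ω (gen j) ∈ θ.range := hθ ▸ ⟨gen j, rfl⟩
    obtain ⟨e, he⟩ := this
    obtain ⟨w, rfl⟩ := hπ e
    exact ⟨w, he⟩
  choose y hy using hgen
  obtain ⟨n, hn1, hn2⟩ : ∃ n, (∀ r ∈ R, l r ∈ deepKer ω n) ∧
      ∀ j, (gen j)⁻¹ * l (y j) ∈ deepKer ω n := by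
    refine Filter.Eventually.exists (f := Filter.atTop) (Filter.Eventually.and ?_ ?_)
    · refine (Filter.eventually_all_finite hR).2 fun r hr => eventually_mem_deepKer hω ?_
      have : r ∈ π.ker := hker ▸ Subgroup.subset_normalClosure hr
      rw [hl, this, map_one]
    · refine Filter.eventually_all.2 fun j => eventually_mem_deepKer hω ?_
      rw [map_mul, map_inv, hl, hy, inv_mul_cancel]
  have hdeep : π.ker ≤ (deepKer ω n).comap l := by
    rw [← hker]
    exact Subgroup.normalClosure_le_normal hn1
  have hsurj : ∀ g, ∃ w, g⁻¹ * l w ∈ deepKer ω n := by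
    intro g
    induction g using KV.induction with
    | one => exact ⟨1, by simp⟩
    | gen_mul j g ih =>
      obtain ⟨w, hw⟩ := ih
      refine ⟨y j * w, ?_⟩
      have := mul_mem (Subgroup.Normal.conj_mem inferInstance _ (hn2 j) g⁻¹) hw
      convert this using 1
      rw [map_mul]
      group
  let v : List X := List.replicate n 1
  have hv : v.length = n := List.length_replicate
  have : ((vertexStab ω v).comap l).FiniteIndex := ⟨by
    rw [Subgroup.index_comap]
    exact Subgroup.FiniteIndex.index_ne_zero (H := (vertexStab ω v).subgroupOf l.range)⟩
  refine large_KV.of_surjective hπ ((vertexStab ω v).comap l)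
    (s := (secHom ω v).comp (l.subgroupComap (vertexStab ω v))) ?_ ?_
  · intro g
    obtain ⟨⟨h, hh⟩, rfl⟩ := secHom_replicate_surjective ω n g
    obtain ⟨w, hw⟩ := hsurj h
    obtain ⟨k1, k2⟩ := hw v hv
    have hlw : l w = h * (h⁻¹ * l w) := by group
    refine ⟨⟨w, ?_⟩, ?_⟩
    · change (tree ω (l w)).1 v = v
      rw [hlw, tree_mul_apply, k1, mem_vertexStab.1 hh]
    · change sec ω v (l w) = sec ω v h
      rw [hlw, sec_mul, k1, k2, mul_one]
  · intro w hw
    exact (hdeep hw v hv).2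

/-! ### The universal groups are not large -/

/-- The elements of `H` which act trivially through all `G_ω`, where `ω ∈ Ψ` has the prefix `u`. -/
def cylinderKer (Ψ : Set Om) (H : Subgroup KV) {n : ℕ} (u : Fin n → Fin 3) : Subgroup H :=
  ⨅ ω ∈ {ω ∈ Ψ | ∀ k : Fin n, ω k = u k}, ((tree ω).comp H.subtype).ker

theorem mem_cylinderKer {Ψ : Set Om} {H : Subgroup KV} {n : ℕ} {u : Fin n → Fin 3} {g : H} :
    g ∈ cylinderKer Ψ H u ↔ ∀ ω ∈ Ψ, (∀ k : Fin n, ω k = u k) → tree ω g = 1 := by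
  simp [cylinderKer, Subgroup.mem_iInf, MonoidHom.mem_ker]

instance (Ψ : Set Om) (H : Subgroup KV) {n : ℕ} (u : Fin n → Fin 3) :
    (cylinderKer Ψ H u).Normal :=
  Subgroup.normal_iInf_normal fun _ => Subgroup.normal_iInf_normal fun _ => inferInstance

/-- The elements of `L` which act trivially on the subtree at `v`, through all `G_ω`, where
`ω ∈ Ψ` has the prefix `u`. All elements of `L` are assumed to fix `v`. -/
def subtreeKer (Ψ : Set Om) {n : ℕ} (u : Fin n → Fin 3) {L : Type*} [Group L] {ω₀ : Om}
    {v : List X} (t : L →* vertexStab ω₀ v) : Subgroup L :=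
  ⨅ ω ∈ {ω ∈ Ψ | ∀ k : Fin n, ω k = u k}, ((tree (shift^[n] ω)).comp ((secHom ω₀ v).comp t)).ker

theorem mem_subtreeKer {Ψ : Set Om} {n : ℕ} {u : Fin n → Fin 3} {L : Type*} [Group L] {ω₀ : Om}
    {v : List X} {t : L →* vertexStab ω₀ v} {g : L} :
    g ∈ subtreeKer Ψ u t ↔
      ∀ ω ∈ Ψ, (∀ k : Fin n, ω k = u k) → tree (shift^[n] ω) (sec ω₀ v (t g)) = 1 := by
  simp [subtreeKer, Subgroup.mem_iInf, MonoidHom.mem_ker, secHom]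

instance (Ψ : Set Om) {n : ℕ} (u : Fin n → Fin 3) {L : Type*} [Group L] {ω₀ : Om}
    {v : List X} (t : L →* vertexStab ω₀ v) : (subtreeKer Ψ u t).Normal :=
  Subgroup.normal_iInf_normal fun _ => Subgroup.normal_iInf_normal fun _ => inferInstance

theorem not_commute_pow_pow {α : Type*} {i j : α} (hij : i ≠ j) {r s : ℕ} (hr : r ≠ 0)
    (hs : s ≠ 0) : ¬ Commute (FreeGroup.of i ^ r) (FreeGroup.of j ^ s) := by
  intro h
  have hi : FreeGroup.of i ^ r ≠ 1 := by
    rw [Ne, pow_eq_one_iff_left hr]; exact FreeGroup.of_ne_one i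
  have hj : FreeGroup.of j ^ s ≠ 1 := by
    rw [Ne, pow_eq_one_iff_left hs]; exact FreeGroup.of_ne_one j
  have h1 : Commute (FreeGroup.of i) (FreeGroup.of j ^ s) :=
    IsFreeGroup.commute_trans hi ((Commute.refl _).pow_left r) h
  have h2 : Commute (FreeGroup.of i) (FreeGroup.of j) :=
    IsFreeGroup.commute_trans hj h1.symm ((Commute.refl _).pow_left s)
  have h3 : [i, j] = [j, i] := FreeGroup.prod_map_of_injective (by simpa using h2.eq)
  exact hij (List.cons.inj h3).1

/-- A homomorphism from a finite index subgroup to a free group, with nonabelian image, which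
kills all elements that act trivially through every `G_ω`, `ω ∈ Ψ`, kills for each `n` all
elements that fix some vertex `v` of level `n` and act trivially on the subtree at `v` through the
groups `G_ω` with `ω ∈ Ψ` in some cylinder of depth `n`. -/
theorem exists_kills_vertex {Ψ : Set Om} {H : Subgroup KV} [H.FiniteIndex] {α : Type*}
    {φ : H →* FreeGroup α} (hφ : ∀ g : H, (∀ ω ∈ Ψ, tree ω g = 1) → φ g = 1) {p q : H} {i j : α}
    (hij : i ≠ j) (hp : φ p = FreeGroup.of i) (hq : φ q = FreeGroup.of j) (n : ℕ) :
    ∃ (ω : Om) (v : List X), v.length = n ∧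
      ∀ g : H, (tree ω g).1 v = v → sec ω v g = 1 → φ g = 1 := by
  have hpq : ¬ Commute (φ p) (φ q) := by
    have := not_commute_pow_pow hij one_ne_zero one_ne_zero
    rwa [pow_one, pow_one, ← hp, ← hq] at this
  obtain ⟨u, hu⟩ := IsFreeGroup.exists_le_ker_of_iInf_le_ker hpq
    (fun u : Fin n → Fin 3 => cylinderKer Ψ H u) (fun _ => inferInstance) fun g hg =>
      hφ g fun ω hω => mem_cylinderKer.1 (Subgroup.mem_iInf.1 hg fun k => ω k) ω hω fun _ => rfl
  obtain ⟨ω₀, -, hω₀⟩ : ∃ ω ∈ Ψ, ∀ k : Fin n, ω k = u k := by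
    by_contra! hcon
    have : φ p = 1 := hu (mem_cylinderKer.2 fun ω hω h => by
      obtain ⟨k, hk⟩ := hcon ω hω
      exact absurd (h k) hk)
    exact FreeGroup.of_ne_one i (hp.symm.trans this)
  -- Elements of the cylinder `u` act on the level `n` as `ω₀` does, with the same sections.
  have hagree : ∀ ω : Om, (∀ k : Fin n, ω k = u k) → ∀ v : List X, v.length = n →
      ∀ k < v.length, ω k = ω₀ k := fun ω hω v hv k hk =>
    (hω ⟨k, hv ▸ hk⟩).trans (hω₀ ⟨k, hv ▸ hk⟩).symm
  let L : Subgroup H := (⨅ v : List.Vector X n, vertexStab ω₀ v.1).subgroupOf H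
  have hLst : (⨅ v : List.Vector X n, vertexStab ω₀ v.1).FiniteIndex :=
    Subgroup.finiteIndex_iInf fun _ => inferInstance
  have hL : L.index ≠ 0 := Subgroup.FiniteIndex.index_ne_zero
  have hLv : ∀ (v : List.Vector X n) (g : L), (g : KV) ∈ vertexStab ω₀ v.1 := fun v g =>
    Subgroup.mem_iInf.1 (Subgroup.mem_subgroupOf.1 g.2) v
  let t : ∀ v : List.Vector X n, L →* vertexStab ω₀ v.1 := fun v =>
    (H.subtype.comp L.subtype).codRestrict _ (hLv v)
  obtain ⟨r, hr, -, hrL⟩ := Subgroup.exists_pow_mem_of_index_ne_zero hL p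
  obtain ⟨s, hs, -, hsL⟩ := Subgroup.exists_pow_mem_of_index_ne_zero hL q
  obtain ⟨v, hv⟩ := IsFreeGroup.exists_le_ker_of_iInf_le_ker (φ := φ.comp L.subtype)
    (x := ⟨p ^ r, hrL⟩) (y := ⟨q ^ s, hsL⟩)
    (by
      have := not_commute_pow_pow hij hr.ne' hs.ne'
      simpa [hp, hq] using this)
    (fun v : List.Vector X n => subtreeKer Ψ u (t v)) (fun _ => inferInstance) (by
      intro g hg
      refine hu (mem_cylinderKer.2 fun ω hω hωu => tree_eq_one (n := n) fun v hv => ?_)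
      rw [tree_congr (hagree ω hωu v hv), sec_congr (hagree ω hωu v hv)]
      exact ⟨hLv ⟨v, hv⟩ g, mem_subtreeKer.1 (Subgroup.mem_iInf.1 hg ⟨v, hv⟩) ω hω hωu⟩)
  refine ⟨ω₀, v.1, v.2, fun g hgv hg => ?_⟩
  -- Some power of `g` fixes the whole level `n`; free groups are torsion-free.
  obtain ⟨r, hr, -, hrL⟩ := Subgroup.exists_pow_mem_of_index_ne_zero hL g
  have hpow : sec ω₀ v.1 (g ^ r : H) = 1 := by
    have := map_pow (secHom ω₀ v.1) ⟨g, hgv⟩ r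
    rw [show secHom ω₀ v.1 ⟨g, hgv⟩ = 1 from hg, one_pow] at this
    exact this
  have hker : φ (g ^ r) = 1 :=
    hv (show (⟨g ^ r, hrL⟩ : L) ∈ subtreeKer Ψ u (t v) from mem_subtreeKer.2 fun ω _ _ => by
      change tree _ (sec ω₀ v.1 (g ^ r : H)) = 1
      rw [hpow, map_one])
  rwa [map_pow, pow_eq_one_iff_left hr.ne'] at hker

/-- A finite index subgroup of `⟨a, b, c, d⟩` has no homomorphism to a free group with nonabelian
image that kills all elements acting trivially through every `G_ω`, `ω ∈ Ψ`. The `2 ^ 2 ^ m`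
positive words of length `2 ^ m` in two elements `p`, `q` with free images have distinct images,
but for a suitable vertex `v` of level about `m` the image of a word is determined by the image of
`v` and the section at `v`, which leaves only `O(2 ^ m)` possibilities. -/
theorem false_of_kills {Ψ : Set Om} {H : Subgroup KV} [H.FiniteIndex] {α : Type*}
    {φ : H →* FreeGroup α} (hφ : ∀ g : H, (∀ ω ∈ Ψ, tree ω g = 1) → φ g = 1) {p q : H} {i j : α}
    (hij : i ≠ j) (hp : φ p = FreeGroup.of i) (hq : φ q = FreeGroup.of j) : False := by
  obtain ⟨k, hkp, hkq⟩ : ∃ k, AltLen (2 ^ k) (p : KV) ∧ AltLen (2 ^ k) (q : KV) := by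
    obtain ⟨k, hk⟩ := AltLen.exists_altLen (p : KV)
    obtain ⟨l, hl⟩ := AltLen.exists_altLen (q : KV)
    have := Nat.lt_two_pow_self (n := k + l)
    exact ⟨k + l, hk.mono (by omega), hl.mono (by omega)⟩
  have hfin : Finite {g | AltLen 2 g} := AltLen.finite 2
  obtain ⟨κ, hκ⟩ : ∃ κ, Nat.card {g | AltLen 2 g} = κ := ⟨_, rfl⟩
  let m := k + κ + 3
  let n := k + m + 1
  obtain ⟨ω, v, hvn, hv⟩ := exists_kills_vertex hφ hij hp hq n
  let word : (Fin (2 ^ m) → Bool) → H := fun l => ((List.ofFn l).map fun e => cond e p q).prod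
  have hword : Injective (φ ∘ word) := by
    intro l l' h
    have key : ∀ l, φ (word l) =
        (((List.ofFn l).map fun e => cond e i j).map FreeGroup.of).prod := by
      intro l
      simp only [word, map_list_prod, List.map_map]
      congr 2
      funext e
      cases e <;> simp [hp, hq]
    simp only [comp_apply, key] at h
    refine List.ofFn_injective (List.map_injective_iff.2 ?_ (FreeGroup.prod_map_of_injective h))
    intro e e' hee
    cases e <;> cases e' <;> simp [hij, hij.symm] at hee ⊢
  have hlen : ∀ l, AltLen (2 ^ (k + m)) (word l : KV) := by
    intro l
    have := AltLen.list_prod (k := 2 ^ k) (l := (List.ofFn l).map fun e => (cond e p q : KV)) (by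
      intro g hg
      obtain ⟨e, -, rfl⟩ := List.mem_map.1 hg
      cases e <;> assumption)
    rw [List.length_map, List.length_ofFn, ← pow_add] at this
    convert this
    simp only [word, Subgroup.val_list_prod, List.map_map]
    congr 2
    funext e
    cases e <;> rfl
  let val : (Fin (2 ^ m) → Bool) → List.Vector X n × {g | AltLen 2 g} := fun l =>
    (⟨(tree ω (word l)).1 v, (length_tree _ _ _).trans hvn⟩,
      ⟨sec ω v (word l), ((hlen l).mono (Nat.le_add_right _ 2)).sec ω (by omega)⟩)
  have hcard : Nat.card (List.Vector X n × {g | AltLen 2 g}) <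
      Nat.card (Fin (2 ^ m) → Bool) := by
    rw [Nat.card_prod, hκ, Nat.card_eq_fintype_card, card_vector, Nat.card_eq_fintype_card,
      Fintype.card_fun, Fintype.card_bool, Fintype.card_fin, Fintype.card_fin]
    calc 2 ^ n * κ < 2 ^ n * 2 ^ κ :=
          Nat.mul_lt_mul_of_pos_left Nat.lt_two_pow_self (by positivity)
      _ = 2 ^ (n + κ) := (pow_add _ _ _).symm
      _ ≤ 2 ^ 2 ^ m := Nat.pow_le_pow_right two_pos ?_
    have h1 : 2 ^ m = 8 * 2 ^ (k + κ) := by rw [pow_add]; ring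
    have h2 := Nat.lt_two_pow_self (n := k + κ)
    omega
  obtain ⟨l, l', hne, hval⟩ : ∃ l l', l ≠ l' ∧ val l = val l' := by
    by_contra! hcon
    exact (Nat.card_le_card_of_injective val fun l l' h =>
      by_contra fun hne => hcon l l' hne h).not_gt hcard
  have h1 : (tree ω (word l)).1 v = (tree ω (word l')).1 v :=
    congrArg (fun z => z.1.1) hval
  have h2 : sec ω v (word l) = sec ω v (word l') := congrArg (fun z => z.2.1) hval
  have hfix : (tree ω ((word l')⁻¹ * word l : H)).1 v = v := by
    rw [Subgroup.coe_mul, tree_mul_apply, h1, ← tree_mul_apply, Subgroup.coe_inv, inv_mul_cancel,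
      tree_one_apply]
  have hsec : sec ω v ((word l')⁻¹ * word l : H) = 1 := by
    have h3 := sec_mul ω v (word l') ((word l')⁻¹ * word l : H)
    rw [hfix, ← Subgroup.coe_mul, mul_inv_cancel_left, h2] at h3
    exact left_eq_mul.1 h3
  have h3 := hv _ hfix hsec
  rw [map_mul, map_inv, inv_mul_eq_one] at h3
  exact hne (hword h3.symm)

theorem tree_mk (ω : Om) (w : FreeGroup (Fin 4)) :
    tree ω (PresentedGroup.mk kleinRels w) = cover ω w := by
  have : (tree ω).comp (PresentedGroup.mk kleinRels) = (G ω).subtype.comp (cover ω) := by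
    ext1 i
    simp only [MonoidHom.comp_apply, cover, FreeGroup.lift_apply_of]
    exact tree_gen ω i
  exact DFunLike.congr_fun this w

theorem mem_MInter {Ψ : Set Om} {w : FreeGroup (Fin 4)} :
    w ∈ MInter Ψ ↔ ∀ ω ∈ Ψ, tree ω (PresentedGroup.mk kleinRels w) = 1 := by
  simp [MInter, M, Subgroup.mem_iInf, MonoidHom.mem_ker, tree_mk]

theorem not_large_U (Ψ : Set Om) : ¬ Large (U Ψ) := by
  intro h
  obtain ⟨H, hH, α, f, x, y, i, j, hij, hx, hy⟩ := h.exists_map_eq_of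
  let π : KV →* U Ψ := QuotientGroup.lift _ (QuotientGroup.mk' (MInter Ψ))
    (Subgroup.normalClosure_le_normal (N := (QuotientGroup.mk' (MInter Ψ)).ker) fun r hr => by
      refine (QuotientGroup.eq_one_iff r).2 (mem_MInter.2 fun ω _ => ?_)
      rw [PresentedGroup.one_of_mem hr, map_one])
  have hπ : ∀ w, π (PresentedGroup.mk kleinRels w) = QuotientGroup.mk' (MInter Ψ) w :=
    fun _ => rfl
  have hsurj : Surjective π := fun z => by
    obtain ⟨w, rfl⟩ := QuotientGroup.mk'_surjective _ z
    exact ⟨_, hπ w⟩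
  have hone : ∀ g, (∀ ω ∈ Ψ, tree ω g = 1) → π g = 1 := fun g hg => by
    obtain ⟨w, rfl⟩ := PresentedGroup.mk_surjective kleinRels g
    rw [hπ]
    exact (QuotientGroup.eq_one_iff w).2 (mem_MInter.2 hg)
  have hfi : (H.comap π).FiniteIndex :=
    ⟨by rw [H.index_comap_of_surjective hsurj]; exact hH.index_ne_zero⟩
  obtain ⟨p, hp⟩ := π.subgroupComap_surjective_of_surjective H hsurj x
  obtain ⟨q, hq⟩ := π.subgroupComap_surjective_of_surjective H hsurj y
  refine false_of_kills (Ψ := Ψ) (φ := f.comp (π.subgroupComap H)) (p := p) (q := q) ?_ hij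
    (by rw [MonoidHom.comp_apply, hp, hx]) (by rw [MonoidHom.comp_apply, hq, hy])
  intro g hg
  have : π.subgroupComap H g = 1 := Subtype.ext (hone g hg)
  rw [MonoidHom.comp_apply, this, map_one]

theorem large_of_surjective_U {Ψ : Set Om} {ω : Om} (hΨ : ω ∈ Ψ) (hω : ω ∈ OmPlus) {E : Type*}
    [Group E] [Group.IsFinitelyPresented E] {f : E →* U Ψ} (hf : Surjective f) : Large E := by
  let p : U Ψ →* TreeAut := QuotientGroup.lift (MInter Ψ)
    ((tree ω).comp (PresentedGroup.mk kleinRels)) fun w hw => mem_MInter.1 hw ω hΨ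
  have hp : ∀ w, p (QuotientGroup.mk' (MInter Ψ) w) = tree ω (PresentedGroup.mk kleinRels w) :=
    fun w => rfl
  refine large_of_range_eq hω (p.comp f) (le_antisymm ?_ ?_)
  · rintro _ ⟨e, rfl⟩
    obtain ⟨w, hw⟩ := QuotientGroup.mk'_surjective _ (f e)
    exact ⟨_, by rw [MonoidHom.comp_apply, ← hw, hp]⟩
  · rintro _ ⟨g, rfl⟩
    obtain ⟨w, rfl⟩ := PresentedGroup.mk_surjective kleinRels g
    obtain ⟨e, he⟩ := hf (QuotientGroup.mk' (MInter Ψ) w)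
    exact ⟨e, by rw [MonoidHom.comp_apply, he, hp]⟩

theorem infinitelyPresented_U {Ψ : Set Om} (hΨ : (Ψ ∩ OmPlus).Nonempty) :
    InfinitelyPresented (U Ψ) := by
  obtain ⟨ω, h1, h2⟩ := hΨ
  refine ⟨inferInstance, fun h => not_large_U Ψ ?_⟩
  exact large_of_surjective_U h1 h2 (f := MonoidHom.id (U Ψ)) surjective_id

theorem omPlus_nonempty : OmPlus.Nonempty := by
  refine ⟨fun n => if Even n then 0 else 1, ?_⟩
  rintro ⟨x, N, h⟩
  have h0 := h (2 * N) (by omega)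
  have h1 := h (2 * N + 1) (by omega)
  rw [← h0] at h1
  simp at h1

end Grigorchuk

theorem corollary3p9 :
    (∀ Ψ : Set Grigorchuk.Om, (Ψ ∩ Grigorchuk.OmPlus).Nonempty →
      Grigorchuk.InfinitelyPresented (Grigorchuk.U Ψ) ∧
      ∀ (E : Type*) [Group E] [Group.IsFinitelyPresented E] (f : E →* Grigorchuk.U Ψ),
        Function.Surjective f → Grigorchuk.Large E) ∧
    Grigorchuk.InfinitelyPresented (Grigorchuk.U Set.univ) := by
  refine ⟨fun Ψ hΨ => ⟨Grigorchuk.infinitelyPresented_U hΨ, fun E _ _ f hf => ?_⟩,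
    Grigorchuk.infinitelyPresented_U (by simpa using Grigorchuk.omPlus_nonempty)⟩
  obtain ⟨ω, h1, h2⟩ := hΨ
  exact Grigorchuk.large_of_surjective_U h1 h2 hf
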